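/- **Setting.** Let $\omega$ be a free ultrafilter on $\mathbb N$. For a C$^*$-algebra $B$ write $B_\omega=\ell^\infty(B)/\{(x_n):\lim_{n\to\omega}\|x_n\|=0\}$, regard $B\subseteq B_\omega$ as constant sequences, and let $F_\omega(B)=(B_\omega\cap B')/\mathrm{Ann}(B)$, where $\mathrm{Ann}(B)=\{x\in B_\omega: xb=bx=0\ \text{for all } b\in B\}$. A lower semicontinuous trace on $B$ is a lower semicontinuous map $\rho:B_+\to[0,\infty]$ with $\rho(0)=0$, $\rho(x+y)=\rho(x)+\rho(y)$, $\rho(\lambda x)=\lambda\rho(x)$ for $\lambda>0$, and $\rho(y^*y)=\rho(yy^*)$ for all $y\in B$. A sequence $(\rho_n)$ of such traces induces the generalised limit trace $\rho:(B_\omega)_+\to[0,\infty]$, $$\rho((x_n))=\sup_{\varepsilon>0}\lim_{n\to\omega}\rho_n((x_n-\varepsilon)_+),\qquad (x_n)\in\ell^\infty(B)_+ .$$ For $b\in B_+$ with $\rho(b)<\infty$, $\rho_b$ denotes the bounded trace on $F_\omega(B)$, i.e. the unique bounded positive linear functional with the trace property, such that $\rho_b([x])=\rho(bx)$ for all positive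 $x\in B_\omega\cap B'$. Let $\mathbb K$ be the compact operators on $\ell^2$ with matrix units $e_{ij}$ and canonical trace $\mathrm{Tr}$, and let $1_n$ be the unit of $\mathbb M_n\subseteq\mathbb K$. For a C$^*$-algebra $A$, let $\bar\Phi:F_\omega(A)\to F_\omega(A\otimes\mathbb K)$ be the $^*$-homomorphism induced by $(x_n)\mapsto(x_n\otimes 1_n)$. **Proposition.** Let $A$ be a separable C$^*$-algebra and let $(\sigma_n)$ be a sequence of lower semicontinuous traces on $A\otimes\mathbb K$. There is a unique sequence $(\tau_n)$ of lower semicontinuous traces on $A$ with $\sigma_n=\tau_n\otimes\mathrm{Tr}$, i.e. $\sigma_n\big(\sum_{i,j} b_{ij}\otimes e_{ij}\big)=\sum_i\tau_n(b_{ii})$ for all $\sum_{i,j} b_{ij}\otimes e_{ij}\in(A\otimes\mathbb K)_+$. Let $\sigma$ and $\tau$ be the generalised limit traces induced by $(\sigma_n)$ and $(\tau_n)$. Let $a=\sum_{i,j}a_{ij}\otimes e_{ij}\in(A\otimes\mathbb K)_+$ with $\sigma(a)<\infty$. Then $\tau(a_{ii})<\infty$ for all $i$, the bounded traces $\sigma_a$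 on $F_\omega(A\otimes\mathbb K)$ and $\tau_{a_{ii}}$ on $F_\omega(A)$ exist and are unique, and $$\sigma_a\circ\bar\Phi=\sum_{i}\tau_{a_{ii}},$$ where the series of bounded traces on $F_\omega(A)$ converges (unconditionally) in norm. -/

import Mathlib

open Filter Topology
open scoped ENNReal ComplexOrder CStarAlgebra

/-! ## Quotients of C⋆-algebras -/

/-- A closed two-sided ⋆-ideal of a C⋆-algebra. -/
structure CStarIdeal (B : Type*) [NonUnitalCStarAlgebra B] extends Submodule ℂ B where
  mul_mem_left' : ∀ (b : B) {x : B}, x ∈ carrier → b * x ∈ carrier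
  mul_mem_right' : ∀ {x : B} (b : B), x ∈ carrier → x * b ∈ carrier
  star_mem' : ∀ {x : B}, x ∈ carrier → star x ∈ carrier
  isClosed' : IsClosed carrier

namespace CStarIdeal

variable {B : Type*} [NonUnitalCStarAlgebra B] (I : CStarIdeal B)

/-- The quotient C⋆-algebra `B / I`, with the quotient norm. -/
def Quot : Type _ := B ⧸ I.toSubmodule

instance : IsClosed (I.toSubmodule : Set B) := I.isClosed'

noncomputable instance : NormedAddCommGroup I.Quot :=
  inferInstanceAs (NormedAddCommGroup (B ⧸ I.toSubmodule))

noncomputable instance : NormedSpace ℂ I.Quot :=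
  inferInstanceAs (NormedSpace ℂ (B ⧸ I.toSubmodule))

instance : CompleteSpace I.Quot :=
  inferInstanceAs (CompleteSpace (B ⧸ I.toSubmodule))

/-- The quotient map, as a linear map. -/
def mkₗ : B →ₗ[ℂ] I.Quot := I.toSubmodule.mkQ

theorem mkₗ_surjective : Function.Surjective I.mkₗ := I.toSubmodule.mkQ_surjective

theorem mkₗ_eq_mkₗ {x y : B} : I.mkₗ x = I.mkₗ y ↔ x - y ∈ I.toSubmodule :=
  Submodule.Quotient.eq I.toSubmodule

theorem mkₗ_eq_zero {x : B} : I.mkₗ x = 0 ↔ x ∈ I.toSubmodule :=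
  Submodule.Quotient.mk_eq_zero I.toSubmodule

theorem norm_mkₗ_le (x : B) : ‖I.mkₗ x‖ ≤ ‖x‖ :=
  Submodule.Quotient.norm_mk_le I.toSubmodule x

theorem exists_norm_lt (q : I.Quot) {ε : ℝ} (hε : 0 < ε) :
    ∃ x : B, I.mkₗ x = q ∧ ‖x‖ < ‖q‖ + ε :=
  Submodule.Quotient.norm_mk_lt (S := I.toSubmodule) q hε

instance : Mul I.Quot where
  mul := Quotient.map₂ (· * ·) fun a b hab c d hcd => by
    have h1 : a - b ∈ I.toSubmodule := I.toSubmodule.quotientRel_def.mp hab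
    have h2 : c - d ∈ I.toSubmodule := I.toSubmodule.quotientRel_def.mp hcd
    refine I.toSubmodule.quotientRel_def.mpr ?_
    have h : a * c - b * d = (a - b) * c + b * (c - d) := by
      rw [sub_mul, mul_sub]; abel
    rw [h]
    exact I.toSubmodule.add_mem (I.mul_mem_right' c h1) (I.mul_mem_left' b h2)

instance : Star I.Quot where
  star := Quotient.map star fun a b hab => by
    have h1 : a - b ∈ I.toSubmodule := I.toSubmodule.quotientRel_def.mp hab
    refine I.toSubmodule.quotientRel_def.mpr ?_
    rw [← star_sub]
    exact I.star_mem' h1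

theorem mkₗ_mul (x y : B) : I.mkₗ (x * y) = I.mkₗ x * I.mkₗ y := rfl

theorem mkₗ_star (x : B) : I.mkₗ (star x) = star (I.mkₗ x) := rfl

theorem quot_norm_mul_le (p q : I.Quot) : ‖p * q‖ ≤ ‖p‖ * ‖q‖ := by
  have key : ∀ ε : ℝ, 0 < ε → ‖p * q‖ ≤ (‖p‖ + ε) * (‖q‖ + ε) := by
    intro ε hε
    obtain ⟨x, rfl, hx⟩ := I.exists_norm_lt p hε
    obtain ⟨y, rfl, hy⟩ := I.exists_norm_lt q hε
    rw [← mkₗ_mul]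
    calc ‖I.mkₗ (x * y)‖ ≤ ‖x * y‖ := I.norm_mkₗ_le _
      _ ≤ ‖x‖ * ‖y‖ := norm_mul_le _ _
      _ ≤ _ := by gcongr
  have hlim : Tendsto (fun ε : ℝ => (‖p‖ + ε) * (‖q‖ + ε)) (𝓝[>] 0)
      (𝓝 ((‖p‖ + 0) * (‖q‖ + 0))) :=
    (Continuous.tendsto (by fun_prop) 0).mono_left nhdsWithin_le_nhds
  simp only [add_zero] at hlim
  exact ge_of_tendsto hlim (eventually_nhdsWithin_of_forall fun ε hε => key ε hε)

noncomputable instance : NonUnitalNormedRing I.Quot where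
  __ := (inferInstance : NormedAddCommGroup I.Quot)
  left_distrib := by
    intro a b c
    obtain ⟨a, rfl⟩ := I.mkₗ_surjective a
    obtain ⟨b, rfl⟩ := I.mkₗ_surjective b
    obtain ⟨c, rfl⟩ := I.mkₗ_surjective c
    rw [← map_add, ← mkₗ_mul, ← mkₗ_mul, ← mkₗ_mul, ← map_add, mul_add]
  right_distrib := by
    intro a b c
    obtain ⟨a, rfl⟩ := I.mkₗ_surjective a
    obtain ⟨b, rfl⟩ := I.mkₗ_surjective b
    obtain ⟨c, rfl⟩ := I.mkₗ_surjective c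
    rw [← map_add, ← mkₗ_mul, ← mkₗ_mul, ← mkₗ_mul, ← map_add, add_mul]
  zero_mul := by
    intro a
    obtain ⟨a, rfl⟩ := I.mkₗ_surjective a
    rw [← map_zero I.mkₗ, ← mkₗ_mul, zero_mul]
  mul_zero := by
    intro a
    obtain ⟨a, rfl⟩ := I.mkₗ_surjective a
    rw [← map_zero I.mkₗ, ← mkₗ_mul, mul_zero]
  mul_assoc := by
    intro a b c
    obtain ⟨a, rfl⟩ := I.mkₗ_surjective a
    obtain ⟨b, rfl⟩ := I.mkₗ_surjective b
    obtain ⟨c, rfl⟩ := I.mkₗ_surjective c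
    simp only [← mkₗ_mul, mul_assoc]
  norm_mul_le := I.quot_norm_mul_le

instance : StarRing I.Quot where
  star_involutive := by
    intro a
    obtain ⟨a, rfl⟩ := I.mkₗ_surjective a
    rw [← mkₗ_star, ← mkₗ_star, star_star]
  star_mul := by
    intro a b
    obtain ⟨a, rfl⟩ := I.mkₗ_surjective a
    obtain ⟨b, rfl⟩ := I.mkₗ_surjective b
    simp only [← mkₗ_mul, ← mkₗ_star, star_mul]
  star_add := by
    intro a b
    obtain ⟨a, rfl⟩ := I.mkₗ_surjective a
    obtain ⟨b, rfl⟩ := I.mkₗ_surjective b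
    simp only [← map_add, ← mkₗ_star, star_add]

/-- `I` as a closed ⋆-subalgebra. -/
def toStarSubalgebra : NonUnitalStarSubalgebra ℂ B where
  carrier := I.carrier
  add_mem' := I.add_mem'
  zero_mem' := I.zero_mem'
  smul_mem' := I.smul_mem'
  mul_mem' := fun {a _} _ hb => I.mul_mem_left' a hb
  star_mem' := I.star_mem'

instance : IsClosed (I.toStarSubalgebra : Set B) := I.isClosed'

/-- Every element of `I` is approximately fixed by right multiplication with a self-adjoint `e` in
`I` such that left and right multiplication by `1 - e` are contractive on `B`. -/
theorem exists_approx {i : B} (hi : i ∈ I.toSubmodule) {ε : ℝ} (hε : 0 < ε) :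
    ∃ e ∈ I.toSubmodule, star e = e ∧ ‖i - i * e‖ < ε ∧ (∀ z : B, ‖z - e * z‖ ≤ ‖z‖) ∧
      ∀ z : B, ‖z - z * e‖ ≤ ‖z‖ := by
  let _ : PartialOrder I.toStarSubalgebra := CStarAlgebra.spectralOrder _
  let _ : StarOrderedRing I.toStarSubalgebra := CStarAlgebra.spectralOrderedRing _
  let _ : PartialOrder B := CStarAlgebra.spectralOrder _
  let _ : StarOrderedRing B := CStarAlgebra.spectralOrderedRing _
  have hU := CStarAlgebra.increasingApproximateUnit I.toStarSubalgebra
  have := hU.neBot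
  have ht := hU.tendsto_mul_left (⟨i, hi⟩ : I.toStarSubalgebra)
  have hev := (Metric.tendsto_nhds.mp ht) ε hε
  obtain ⟨e, he1, he0, he⟩ := (hev.and (hU.eventually_nonneg.and hU.eventually_norm)).exists
  obtain ⟨f, hf⟩ := CStarAlgebra.nonneg_iff_eq_star_mul_self.mp he0
  have heB : 0 ≤ (e : B) := by
    rw [hf]; exact star_mul_self_nonneg (f : B)
  have hes : star (e : B) = e := (IsSelfAdjoint.of_nonneg heB).star_eq
  have hl : ∀ z : B, ‖z - e * z‖ ≤ ‖z‖ := by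
    intro z
    refine CStarAlgebra.norm_sub_mul_self_le_of_inr (x := 0) z le_rfl heB he (norm_nonneg z) ?_
    rw [Unitization.inr_zero, sub_zero, mul_one, CStarRing.norm_star_mul_self, Unitization.norm_inr, sq]
  refine ⟨e, e.2, hes, ?_, hl, fun z => ?_⟩
  · rw [← norm_neg, neg_sub]
    rw [dist_eq_norm] at he1
    exact he1
  · have := hl (star z)
    rw [← norm_star, norm_star z] at this
    simpa [hes] using this

instance : CStarRing I.Quot where
  norm_mul_self_le := by
    intro q
    obtain ⟨x, rfl⟩ := I.mkₗ_surjective q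
    refine le_of_forall_pos_le_add fun ε hε => ?_
    rw [← mkₗ_star, ← mkₗ_mul]
    obtain ⟨y, hy, hyn⟩ := I.exists_norm_lt (I.mkₗ (star x * x)) (half_pos hε)
    have hi : star x * x - y ∈ I.toSubmodule := I.mkₗ_eq_mkₗ.mp hy.symm
    obtain ⟨e, heI, hes, hie, hl, hr⟩ := I.exists_approx hi (half_pos hε)
    have h1 : ‖I.mkₗ x‖ ≤ ‖x - x * e‖ := by
      have : I.mkₗ x = I.mkₗ (x - x * e) := by
        rw [I.mkₗ_eq_mkₗ, sub_sub_cancel]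
        exact I.mul_mem_left' x heI
      rw [this]
      exact I.norm_mkₗ_le _
    have h2 : ‖x - x * e‖ * ‖x - x * e‖ ≤ ‖star x * x - star x * x * e‖ := by
      rw [← CStarRing.norm_star_mul_self]
      have : star (x - x * e) * (x - x * e) =
          (star x * x - star x * x * e) - e * (star x * x - star x * x * e) := by
        rw [star_sub, star_mul, hes]; noncomm_ring
      rw [this]
      exact hl _
    have h3 : star x * x - star x * x * e
        = (y - y * e) + ((star x * x - y) - (star x * x - y) * e) := by
      noncomm_ring
    calc ‖I.mkₗ x‖ * ‖I.mkₗ x‖ ≤ ‖x - x * e‖ * ‖x - x * e‖ := by gcongr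
      _ ≤ ‖(y - y * e) + ((star x * x - y) - (star x * x - y) * e)‖ := by rw [← h3]; exact h2
      _ ≤ ‖y - y * e‖ + ‖(star x * x - y) - (star x * x - y) * e‖ := norm_add_le _ _
      _ ≤ ‖y‖ + ε / 2 := add_le_add (hr y) hie.le
      _ ≤ _ := by linarith

noncomputable instance : NonUnitalCStarAlgebra I.Quot where
  smul_assoc := by
    intro c a b
    obtain ⟨a, rfl⟩ := I.mkₗ_surjective a
    obtain ⟨b, rfl⟩ := I.mkₗ_surjective b
    simp only [smul_eq_mul, ← map_smul, ← mkₗ_mul, smul_mul_assoc]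
  smul_comm := by
    intro c a b
    obtain ⟨a, rfl⟩ := I.mkₗ_surjective a
    obtain ⟨b, rfl⟩ := I.mkₗ_surjective b
    simp only [smul_eq_mul, ← map_smul, ← mkₗ_mul, mul_smul_comm]
  star_smul := by
    intro c a
    obtain ⟨a, rfl⟩ := I.mkₗ_surjective a
    simp only [← map_smul, ← mkₗ_star, star_smul]

/-- The order of the quotient is the usual one: `0 ≤ q` iff `q = star p * p` for some `p`. -/
noncomputable instance : PartialOrder I.Quot := CStarAlgebra.spectralOrder _

instance : StarOrderedRing I.Quot := CStarAlgebra.spectralOrderedRing _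

/-- The quotient map, as a ⋆-homomorphism. -/
noncomputable def toQuot : B →⋆ₙₐ[ℂ] I.Quot where
  toFun := I.mkₗ
  map_smul' := I.mkₗ.map_smul
  map_zero' := I.mkₗ.map_zero
  map_add' := I.mkₗ.map_add
  map_mul' := I.mkₗ_mul
  map_star' := I.mkₗ_star

theorem toQuot_surjective : Function.Surjective I.toQuot := I.mkₗ_surjective

theorem toQuot_eq_zero {x : B} : I.toQuot x = 0 ↔ x ∈ I.toSubmodule := I.mkₗ_eq_zero

variable {C : Type*} [NonUnitalCStarAlgebra C]

/-- The ⋆-homomorphism on the quotient that is induced by a ⋆-homomorphism vanishing on `I`. -/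
noncomputable def lift (f : B →⋆ₙₐ[ℂ] C) (hf : ∀ x ∈ I.toSubmodule, f x = 0) : I.Quot →⋆ₙₐ[ℂ] C where
  toFun := I.toSubmodule.liftQ (f : B →ₗ[ℂ] C) hf
  map_smul' c q := map_smul (I.toSubmodule.liftQ (f : B →ₗ[ℂ] C) hf) c q
  map_zero' := map_zero (I.toSubmodule.liftQ (f : B →ₗ[ℂ] C) hf)
  map_add' p q := map_add (I.toSubmodule.liftQ (f : B →ₗ[ℂ] C) hf) p q
  map_mul' p q := by
    obtain ⟨a, rfl⟩ := I.mkₗ_surjective p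
    obtain ⟨b, rfl⟩ := I.mkₗ_surjective q
    exact map_mul f a b
  map_star' p := by
    obtain ⟨a, rfl⟩ := I.mkₗ_surjective p
    exact map_star f a

@[simp] theorem lift_toQuot (f : B →⋆ₙₐ[ℂ] C) (hf : ∀ x ∈ I.toSubmodule, f x = 0) (x : B) :
    I.lift f hf (I.toQuot x) = f x := rfl

/-- The preimage of an ideal under a ⋆-homomorphism. -/
def comap (J : CStarIdeal C) (f : B →⋆ₙₐ[ℂ] C) : CStarIdeal B where
  toSubmodule := J.toSubmodule.comap (f : B →ₗ[ℂ] C)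
  mul_mem_left' b {x} hx := by
    change f (b * x) ∈ J.toSubmodule
    rw [map_mul]
    exact J.mul_mem_left' (f b) hx
  mul_mem_right' {x} b hx := by
    change f (x * b) ∈ J.toSubmodule
    rw [map_mul]
    exact J.mul_mem_right' (f b) hx
  star_mem' {x} hx := by
    change f (star x) ∈ J.toSubmodule
    rw [map_star]
    exact J.star_mem' hx
  isClosed' := J.isClosed'.preimage (map_continuous f)

end CStarIdeal

/-! ## Bounded sequences and ultrapowers -/

/-- Bounded sequences `x` with `x n ∈ E n` and `‖x n‖ → 0` along the filter `l`, as an ideal of the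
C⋆-algebra of all bounded sequences. -/
def nullIdeal (l : Filter ℕ) (E : ℕ → Type*) [∀ n, NonUnitalCStarAlgebra (E n)] :
    CStarIdeal (lp E ∞) where
  carrier := {x | Tendsto (fun n => ‖x n‖) l (𝓝 0)}
  add_mem' {x y} hx hy := by
    have := Tendsto.add hx hy
    rw [add_zero] at this
    exact squeeze_zero (fun n => norm_nonneg _) (fun n => norm_add_le (x n) (y n)) this
  zero_mem' := by
    simp only [Set.mem_ofPred_eq, lp.coeFn_zero, Pi.zero_apply, norm_zero]
    exact tendsto_const_nhds
  smul_mem' c x hx := by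
    have := Tendsto.const_mul ‖c‖ hx
    rw [mul_zero] at this
    exact squeeze_zero (fun n => norm_nonneg _) (fun n => norm_smul_le c (x n)) this
  mul_mem_left' b {x} hx := by
    have := Tendsto.const_mul ‖b‖ hx
    rw [mul_zero] at this
    refine squeeze_zero (fun n => norm_nonneg _) (fun n => ?_) this
    exact (norm_mul_le (b n) (x n)).trans
      (mul_le_mul_of_nonneg_right (lp.norm_apply_le_norm ENNReal.top_ne_zero b n) (norm_nonneg _))
  mul_mem_right' {x} b hx := by
    have := Tendsto.mul_const ‖b‖ hx
    rw [zero_mul] at this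
    refine squeeze_zero (fun n => norm_nonneg _) (fun n => ?_) this
    exact (norm_mul_le (x n) (b n)).trans
      (mul_le_mul_of_nonneg_left (lp.norm_apply_le_norm ENNReal.top_ne_zero b n) (norm_nonneg _))
  star_mem' {x} hx := by
    simp only [Set.mem_ofPred_eq, lp.star_apply, norm_star] at hx ⊢
    exact hx
  isClosed' := by
    rw [← isSeqClosed_iff_isClosed]
    intro u x hu hux
    rw [Set.mem_ofPred_eq, Metric.tendsto_nhds]
    intro ε hε
    obtain ⟨k, hk⟩ := ((Metric.tendsto_nhds.mp hux) (ε / 2) (half_pos hε)).exists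
    filter_upwards [(Metric.tendsto_nhds.mp (hu k)) (ε / 2) (half_pos hε)] with n hn
    rw [dist_zero_right, norm_norm] at hn ⊢
    rw [dist_eq_norm, norm_sub_rev] at hk
    have h1 : ‖x n - u k n‖ ≤ ‖x - u k‖ := lp.norm_apply_le_norm ENNReal.top_ne_zero (x - u k) n
    have h2 : ‖x n‖ ≤ ‖x n - u k n‖ + ‖u k n‖ := by
      simpa using norm_add_le (x n - u k n) (u k n)
    linarith

theorem mem_nullIdeal {l : Filter ℕ} {E : ℕ → Type*} [∀ n, NonUnitalCStarAlgebra (E n)]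
    {x : lp E ∞} : x ∈ (nullIdeal l E).toSubmodule ↔ Tendsto (fun n => ‖x n‖) l (𝓝 0) := Iff.rfl

/-- The C⋆-algebra `ℓ^∞(B)` of bounded sequences in `B`. -/
abbrev BddSeq (B : Type*) [NonUnitalCStarAlgebra B] : Type _ := lp (fun _ : ℕ => B) ∞

/-- The coordinatewise application of a sequence of ⋆-homomorphisms `B → E n`. -/
noncomputable def seqMap {B : Type*} [NonUnitalCStarAlgebra B] {E : ℕ → Type*}
    [∀ n, NonUnitalCStarAlgebra (E n)] (f : ∀ n, B →⋆ₙₐ[ℂ] E n) : BddSeq B →⋆ₙₐ[ℂ] lp E ∞ where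
  toFun x := ⟨fun n => f n (x n), memℓp_infty ⟨‖x‖, by
    rintro _ ⟨n, rfl⟩
    exact (NonUnitalStarAlgHom.norm_apply_le (f n) (x n)).trans
      (lp.norm_apply_le_norm ENNReal.top_ne_zero x n)⟩⟩
  map_smul' c x := lp.ext (funext fun n => map_smul (f n) c (x n))
  map_zero' := lp.ext (funext fun n => map_zero (f n))
  map_add' x y := lp.ext (funext fun n => map_add (f n) (x n) (y n))
  map_mul' x y := lp.ext (funext fun n => map_mul (f n) (x n) (y n))
  map_star' x := lp.ext (funext fun n => map_star (f n) (x n))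

@[simp] theorem seqMap_apply {B : Type*} [NonUnitalCStarAlgebra B] {E : ℕ → Type*}
    [∀ n, NonUnitalCStarAlgebra (E n)] (f : ∀ n, B →⋆ₙₐ[ℂ] E n) (x : BddSeq B) (n : ℕ) :
    seqMap f x n = f n (x n) := rfl

/-- The bounded sequence `(f n b)` for a sequence of ⋆-homomorphisms `f n : B → E n`. -/
noncomputable def seqOf {B : Type*} [NonUnitalCStarAlgebra B] {E : ℕ → Type*}
    [∀ n, NonUnitalCStarAlgebra (E n)] (f : ∀ n, B →⋆ₙₐ[ℂ] E n) : B →⋆ₙₐ[ℂ] lp E ∞ where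
  toFun b := ⟨fun n => f n b, memℓp_infty ⟨‖b‖, by
    rintro _ ⟨n, rfl⟩
    exact NonUnitalStarAlgHom.norm_apply_le (f n) b⟩⟩
  map_smul' c x := lp.ext (funext fun n => map_smul (f n) c x)
  map_zero' := lp.ext (funext fun n => map_zero (f n))
  map_add' x y := lp.ext (funext fun n => map_add (f n) x y)
  map_mul' x y := lp.ext (funext fun n => map_mul (f n) x y)
  map_star' x := lp.ext (funext fun n => map_star (f n) x)

@[simp] theorem seqOf_apply {B : Type*} [NonUnitalCStarAlgebra B] {E : ℕ → Type*}
    [∀ n, NonUnitalCStarAlgebra (E n)] (f : ∀ n, B →⋆ₙₐ[ℂ] E n) (b : B) (n : ℕ) :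
    seqOf f b n = f n b := rfl

section Ultrapower

variable (ω : Ultrafilter ℕ) (B : Type*) [NonUnitalCStarAlgebra B]

/-- The ultrapower `B_ω = ℓ^∞(B) / {x | lim_ω ‖x n‖ = 0}`. -/
abbrev Ultrapower : Type _ := (nullIdeal (ω : Filter ℕ) (fun _ : ℕ => B)).Quot

/-- The class in `B_ω` of a bounded sequence. -/
noncomputable def ultraMk : BddSeq B →⋆ₙₐ[ℂ] Ultrapower ω B := (nullIdeal _ _).toQuot

/-- The embedding of `B` into `B_ω` by constant sequences. -/
noncomputable def diagEmb : B →⋆ₙₐ[ℂ] Ultrapower ω B :=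
  (ultraMk ω B).comp (seqOf fun _ => NonUnitalStarAlgHom.id ℂ B)

/-- The relative commutant `B_ω ∩ B'`. -/
noncomputable def relComm : NonUnitalStarSubalgebra ℂ (Ultrapower ω B) :=
  NonUnitalStarSubalgebra.centralizer ℂ (Set.range (diagEmb ω B))

variable {ω B}

theorem mem_relComm {x : Ultrapower ω B} :
    x ∈ relComm ω B ↔ ∀ b : B, diagEmb ω B b * x = x * diagEmb ω B b := by
  rw [relComm, NonUnitalStarSubalgebra.mem_centralizer_iff]
  constructor
  · intro h b
    exact (h _ ⟨b, rfl⟩).1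
  · rintro h _ ⟨b, rfl⟩
    exact ⟨h b, by rw [← map_star]; exact h (star b)⟩

variable (ω B)

instance : IsClosed (relComm ω B : Set (Ultrapower ω B)) := by
  rw [relComm, NonUnitalStarSubalgebra.coe_centralizer]
  exact Set.isClosed_centralizer _

/-- The annihilator of `B` in `B_ω`, `{x | x b = b x = 0 for all b ∈ B}`; it is contained in
`B_ω ∩ B'`, of which it is an ideal. -/
noncomputable def annihilator : CStarIdeal (relComm ω B) where
  carrier := {x | ∀ b : B, (x : Ultrapower ω B) * diagEmb ω B b = 0 ∧
    diagEmb ω B b * (x : Ultrapower ω B) = 0}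
  add_mem' {x y} hx hy b := by
    simp [add_mul, mul_add, hx b, hy b]
  zero_mem' b := by simp
  smul_mem' c x hx b := by
    simp [smul_mul_assoc, mul_smul_comm, hx b]
  mul_mem_left' y {x} hx b := by
    have hy := mem_relComm.mp y.2 b
    constructor
    · simp [mul_assoc, hx b]
    · simp [← mul_assoc, hy]
      simp [mul_assoc, hx b]
  mul_mem_right' {x} y hx b := by
    have hy := mem_relComm.mp y.2 b
    constructor
    · simp [mul_assoc, ← hy]
      simp [← mul_assoc, hx b]
    · simp [← mul_assoc, hx b]
  star_mem' {x} hx b := by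
    have h := hx (star b)
    rw [map_star] at h
    constructor
    · rw [← star_eq_zero]
      simpa using h.2
    · rw [← star_eq_zero]
      simpa using h.1
  isClosed' := by
    simp only [Set.ofPred_forall]
    refine isClosed_iInter fun b => ?_
    exact (isClosed_eq (by fun_prop) continuous_const).and
      (isClosed_eq (by fun_prop) continuous_const)

/-- Kirchberg's central sequence algebra `F_ω(B) = (B_ω ∩ B') / Ann(B)`. -/
abbrev CentralSeqAlg : Type _ := (annihilator ω B).Quot

/-- The quotient map `B_ω ∩ B' → F_ω(B)`. -/
noncomputable def centralMk : relComm ω B →⋆ₙₐ[ℂ] CentralSeqAlg ω B := (annihilator ω B).toQuot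

end Ultrapower

/-! ## The stabilisation -/

section Stabilisation

/-- The C⋆-algebra `M_n(A) = A ⊗ M_n`. -/
def MatAlg (A : Type*) (n : ℕ) : Type _ := CStarMatrix (Fin n) (Fin n) A

variable (A : Type*) [NonUnitalCStarAlgebra A] [PartialOrder A] [StarOrderedRing A]

noncomputable instance (n : ℕ) : NonUnitalCStarAlgebra (MatAlg A n) :=
  inferInstanceAs (NonUnitalCStarAlgebra (CStarMatrix (Fin n) (Fin n) A))

variable {A}

namespace MatAlg

/-- The matrix in `M_n(A)` with the given entries. -/
def of {A : Type*} {n : ℕ} (f : Fin n → Fin n → A) : MatAlg A n := CStarMatrix.ofMatrix f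

/-- The entries of a matrix in `M_n(A)`. -/
def entry {A : Type*} {n : ℕ} (x : MatAlg A n) (i j : Fin n) : A := CStarMatrix.ofMatrix.symm x i j

theorem entry_of {A : Type*} {n : ℕ} (f : Fin n → Fin n → A) (i j : Fin n) : (of f).entry i j = f i j := rfl

theorem ext {A : Type*} {n : ℕ} {x y : MatAlg A n} (h : ∀ i j, x.entry i j = y.entry i j) : x = y :=
  CStarMatrix.ext h

theorem entry_zero {n : ℕ} (i j : Fin n) : (0 : MatAlg A n).entry i j = 0 := rfl

theorem entry_add {n : ℕ} (x y : MatAlg A n) (i j : Fin n) :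
    (x + y).entry i j = x.entry i j + y.entry i j := rfl

theorem entry_sub {n : ℕ} (x y : MatAlg A n) (i j : Fin n) :
    (x - y).entry i j = x.entry i j - y.entry i j := rfl

theorem entry_smul {n : ℕ} (c : ℂ) (x : MatAlg A n) (i j : Fin n) :
    (c • x).entry i j = c • x.entry i j := rfl

theorem entry_mul {n : ℕ} (x y : MatAlg A n) (i j : Fin n) :
    (x * y).entry i j = ∑ k, x.entry i k * y.entry k j := rfl

theorem entry_star {n : ℕ} (x : MatAlg A n) (i j : Fin n) :
    (star x).entry i j = star (x.entry j i) := rfl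

theorem norm_entry_le {n : ℕ} (x : MatAlg A n) (i j : Fin n) : ‖x.entry i j‖ ≤ ‖x‖ :=
  CStarMatrix.norm_entry_le_norm

end MatAlg

/-- The upper left `M × M` corner of the infinite matrix which extends `x ∈ M_N(A)` by zero. -/
def padFun {A : Type*} [Zero A] {N : ℕ} (M : ℕ) (x : MatAlg A N) : MatAlg A M :=
  MatAlg.of fun i j => if hij : (i : ℕ) < N ∧ (j : ℕ) < N then x.entry ⟨i, hij.1⟩ ⟨j, hij.2⟩ else 0

theorem padFun_pos {A : Type*} [Zero A] {N M : ℕ} (x : MatAlg A N) {i j : Fin M}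
    (hij : (i : ℕ) < N ∧ (j : ℕ) < N) :
    (padFun M x).entry i j = x.entry ⟨i, hij.1⟩ ⟨j, hij.2⟩ := dif_pos hij

theorem padFun_neg {A : Type*} [Zero A] {N M : ℕ} (x : MatAlg A N) {i j : Fin M}
    (hij : ¬((i : ℕ) < N ∧ (j : ℕ) < N)) : (padFun M x).entry i j = 0 := dif_neg hij

/-- The upper left corner embedding `M_N(A) → M_M(A)`, `N ≤ M`. -/
noncomputable def padHom {N M : ℕ} (h : N ≤ M) : MatAlg A N →⋆ₙₐ[ℂ] MatAlg A M where
  toFun := padFun M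
  map_smul' c x := by
    refine MatAlg.ext fun i j => ?_
    rw [MonoidHom.id_apply, MatAlg.entry_smul]
    by_cases hij : (i : ℕ) < N ∧ (j : ℕ) < N
    · rw [padFun_pos _ hij, padFun_pos _ hij, MatAlg.entry_smul]
    · rw [padFun_neg _ hij, padFun_neg _ hij, smul_zero]
  map_zero' := by
    refine MatAlg.ext fun i j => ?_
    by_cases hij : (i : ℕ) < N ∧ (j : ℕ) < N
    · rw [padFun_pos _ hij]; rfl
    · rw [padFun_neg _ hij]; rfl
  map_add' x y := by
    refine MatAlg.ext fun i j => ?_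
    rw [MatAlg.entry_add]
    by_cases hij : (i : ℕ) < N ∧ (j : ℕ) < N
    · rw [padFun_pos _ hij, padFun_pos _ hij, padFun_pos _ hij, MatAlg.entry_add]
    · rw [padFun_neg _ hij, padFun_neg _ hij, padFun_neg _ hij, add_zero]
  map_mul' x y := by
    refine MatAlg.ext fun i j => ?_
    rw [MatAlg.entry_mul]
    by_cases hij : (i : ℕ) < N ∧ (j : ℕ) < N
    · rw [padFun_pos _ hij, MatAlg.entry_mul]
      refine Finset.sum_of_injOn (Fin.castLE h) (fun a _ b _ hab => Fin.castLE_injective h hab)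
        (fun _ _ => Finset.mem_univ _) ?_ ?_
      · intro k _ hk
        have hk' : ¬ (k : ℕ) < N := fun hlt => hk ⟨⟨k, hlt⟩, Finset.mem_coe.mpr (Finset.mem_univ _),
          Fin.ext rfl⟩
        rw [padFun_neg x (fun hh => hk' hh.2), zero_mul]
      · intro k _
        have hk : ((Fin.castLE h k : Fin M) : ℕ) < N := k.2
        rw [padFun_pos x ⟨hij.1, hk⟩, padFun_pos y ⟨hk, hij.2⟩]
        rfl
    · rw [padFun_neg _ hij]
      symm
      refine Finset.sum_eq_zero fun k _ => ?_
      by_cases hi : (i : ℕ) < N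
      · rw [padFun_neg y fun hj => hij ⟨hi, hj.2⟩, mul_zero]
      · rw [padFun_neg x fun hj => hi hj.1, zero_mul]
  map_star' x := by
    refine MatAlg.ext fun i j => ?_
    rw [MatAlg.entry_star]
    by_cases hij : (i : ℕ) < N ∧ (j : ℕ) < N
    · rw [padFun_pos _ hij, padFun_pos _ hij.symm, MatAlg.entry_star]
    · rw [padFun_neg _ hij, padFun_neg _ fun hh => hij hh.symm, star_zero]

theorem padHom_pos {N M : ℕ} (h : N ≤ M) (x : MatAlg A N) {i j : Fin M}
    (hij : (i : ℕ) < N ∧ (j : ℕ) < N) :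
    (padHom h x).entry i j = x.entry ⟨i, hij.1⟩ ⟨j, hij.2⟩ := dif_pos hij

theorem padHom_neg {N M : ℕ} (h : N ≤ M) (x : MatAlg A N) {i j : Fin M}
    (hij : ¬((i : ℕ) < N ∧ (j : ℕ) < N)) : (padHom h x).entry i j = 0 := dif_neg hij

theorem padHom_padHom {N M L : ℕ} (h : N ≤ M) (h' : M ≤ L) (x : MatAlg A N) :
    padHom h' (padHom h x) = padHom (h.trans h') x := by
  refine MatAlg.ext fun i j => ?_
  by_cases hij : (i : ℕ) < N ∧ (j : ℕ) < N
  · rw [padHom_pos _ _ hij, padHom_pos _ _ ⟨hij.1.trans_le h, hij.2.trans_le h⟩]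
    exact padHom_pos h x (i := ⟨i, _⟩) (j := ⟨j, _⟩) hij
  · rw [padHom_neg _ _ hij]
    by_cases h1 : (i : ℕ) < M ∧ (j : ℕ) < M
    · rw [padHom_pos _ _ h1]
      exact padHom_neg h x (i := ⟨i, _⟩) (j := ⟨j, _⟩) hij
    · rw [padHom_neg _ _ h1]

variable (A)

/-- The C⋆-algebra `∏ M_n(A)` of bounded sequences of matrices of growing size. -/
abbrev MatSeq : Type _ := lp (fun n : ℕ => MatAlg A n) ∞

/-- The sequences in `∏ M_n(A)` that are eventually constant with respect to the corner
embeddings. -/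
def stableSeq : NonUnitalStarSubalgebra ℂ (MatSeq A) where
  carrier := {x | ∃ N, ∀ M (h : N ≤ M), x M = padHom h (x N)}
  add_mem' {x y} := by
    rintro ⟨N, hN⟩ ⟨N', hN'⟩
    refine ⟨max N N', fun M h => ?_⟩
    rw [lp.coeFn_add, Pi.add_apply, Pi.add_apply, map_add, hN _ (le_max_left N N'),
      hN' _ (le_max_right N N'), padHom_padHom, padHom_padHom, ← hN, ← hN']
  zero_mem' := ⟨0, fun M h => by
    rw [lp.coeFn_zero, Pi.zero_apply, Pi.zero_apply, map_zero]⟩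
  mul_mem' {x y} := by
    rintro ⟨N, hN⟩ ⟨N', hN'⟩
    refine ⟨max N N', fun M h => ?_⟩
    rw [lp.infty_coeFn_mul, Pi.mul_apply, Pi.mul_apply, map_mul, hN _ (le_max_left N N'),
      hN' _ (le_max_right N N'), padHom_padHom, padHom_padHom, ← hN, ← hN']
  smul_mem' c x := by
    rintro ⟨N, hN⟩
    refine ⟨N, fun M h => ?_⟩
    rw [lp.coeFn_smul, Pi.smul_apply, Pi.smul_apply, map_smul, hN M h]
  star_mem' {x} := by
    rintro ⟨N, hN⟩
    refine ⟨N, fun M h => ?_⟩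
    rw [lp.star_apply, lp.star_apply, map_star, hN M h]

/-- The closure of the eventually constant sequences. -/
noncomputable def stableClosure : NonUnitalStarSubalgebra ℂ (MatSeq A) :=
  (stableSeq A).topologicalClosure

instance : IsClosed (stableClosure A : Set (MatSeq A)) :=
  NonUnitalStarSubalgebra.isClosed_topologicalClosure _

/-- The stabilisation `A ⊗ 𝕂`, as the C⋆-inductive limit of the matrix algebras `M_n(A)` along the
upper left corner embeddings. -/
abbrev Stab : Type _ :=
  ((nullIdeal atTop (fun n : ℕ => MatAlg A n)).comap
    (NonUnitalStarSubalgebraClass.subtype (stableClosure A))).Quot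

/-- The quotient map onto `A ⊗ 𝕂`. -/
noncomputable def stabMk : stableClosure A →⋆ₙₐ[ℂ] Stab A := CStarIdeal.toQuot _

variable {A}

theorem stabMk_surjective : Function.Surjective (stabMk A) := CStarIdeal.toQuot_surjective _

theorem stabMk_eq_zero {x : stableClosure A} :
    stabMk A x = 0 ↔ Tendsto (fun n => ‖(x : MatSeq A) n‖) atTop (𝓝 0) :=
  CStarIdeal.toQuot_eq_zero _

open Classical in
/-- The sequence `(0, …, 0, x, x ⊕ 0, x ⊕ 0 ⊕ 0, …)` for `x ∈ M_N(A)`. -/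
noncomputable def cornerSeq (N : ℕ) : MatAlg A N →⋆ₙₐ[ℂ] MatSeq A :=
  seqOf fun M => if h : N ≤ M then padHom h else 0

theorem cornerSeq_apply {N M : ℕ} (h : N ≤ M) (x : MatAlg A N) :
    cornerSeq N x M = padHom h x := by
  simp [cornerSeq, h]

theorem cornerSeq_mem (N : ℕ) (x : MatAlg A N) : cornerSeq N x ∈ stableSeq A :=
  ⟨N, fun M h => by rw [cornerSeq_apply h, cornerSeq_apply le_rfl, padHom_padHom]⟩

/-- The canonical embedding `M_N(A) = A ⊗ M_N → A ⊗ 𝕂`. -/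
noncomputable def corner (N : ℕ) : MatAlg A N →⋆ₙₐ[ℂ] Stab A :=
  (stabMk A).comp (NonUnitalStarAlgHom.codRestrict (cornerSeq N) (stableClosure A)
    fun x => (stableSeq A).le_topologicalClosure (cornerSeq_mem N x))

theorem stabMk_eq_corner {x : stableClosure A} {N : ℕ}
    (h : ∀ M (h : N ≤ M), (x : MatSeq A) M = padHom h ((x : MatSeq A) N)) :
    stabMk A x = corner N ((x : MatSeq A) N) := by
  rw [← sub_eq_zero, corner, NonUnitalStarAlgHom.comp_apply, ← map_sub, stabMk_eq_zero]
  refine tendsto_const_nhds.congr' ?_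
  filter_upwards [eventually_ge_atTop N] with M hM
  have : ((x - (NonUnitalStarAlgHom.codRestrict (cornerSeq N) (stableClosure A)
    fun x => (stableSeq A).le_topologicalClosure (cornerSeq_mem N x)) ((x : MatSeq A) N) :
      stableClosure A) : MatSeq A) M = (x : MatSeq A) M - cornerSeq N ((x : MatSeq A) N) M := rfl
  rw [this, cornerSeq_apply hM, h M hM, sub_self, norm_zero]

theorem corner_padHom {N M : ℕ} (h : N ≤ M) (x : MatAlg A N) :
    corner M (padHom h x) = corner N x := by
  have := stabMk_eq_corner (x := NonUnitalStarAlgHom.codRestrict (cornerSeq N) (stableClosure A)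
    (fun x => (stableSeq A).le_topologicalClosure (cornerSeq_mem N x)) x) (N := M) (by
      intro L hL
      change cornerSeq N x L = padHom hL (cornerSeq N x M)
      rw [cornerSeq_apply h, cornerSeq_apply (h.trans hL), padHom_padHom])
  change corner N x = corner M (cornerSeq N x M) at this
  rw [this, cornerSeq_apply h]

/-- A closed condition on `A ⊗ 𝕂` can be checked on the union of the corners `M_N(A)`. -/
theorem Stab.induction {p : Stab A → Prop} (hp : IsClosed {b | p b})
    (h : ∀ (N : ℕ) (x : MatAlg A N), p (corner N x)) (b : Stab A) : p b := by
  obtain ⟨⟨x, hx⟩, rfl⟩ := stabMk_surjective b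
  have hcl : IsClosed {s : stableClosure A | p (stabMk A s)} :=
    hp.preimage (map_continuous (stabMk A))
  have hx' : x ∈ closure (stableSeq A : Set (MatSeq A)) := hx
  obtain ⟨u, hu, hux⟩ := mem_closure_iff_seq_limit.mp hx'
  have hmem : ∀ k, u k ∈ stableClosure A := fun k => (stableSeq A).le_topologicalClosure (hu k)
  have hlim : Tendsto (fun k => (⟨u k, hmem k⟩ : stableClosure A)) atTop (𝓝 ⟨x, hx⟩) :=
    tendsto_subtype_rng.mpr hux
  refine hcl.mem_of_tendsto hlim (Eventually.of_forall fun k => ?_)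
  obtain ⟨N, hN⟩ := hu k
  change p (stabMk A ⟨u k, hmem k⟩)
  rw [stabMk_eq_corner (N := N) (x := ⟨u k, hmem k⟩) hN]
  exact h N _

/-! ### Matrix entries -/

/-- The `(i, j)` entries of a sequence of matrices of growing size. -/
noncomputable def entrySeq (i j : ℕ) (x : MatSeq A) (n : ℕ) : A :=
  if h : i < n ∧ j < n then (x n).entry ⟨i, h.1⟩ ⟨j, h.2⟩ else 0

theorem norm_entrySeq_le (i j : ℕ) (x : MatSeq A) (n : ℕ) : ‖entrySeq i j x n‖ ≤ ‖x n‖ := by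
  unfold entrySeq
  split_ifs
  · exact MatAlg.norm_entry_le _ _ _
  · simp

theorem entrySeq_sub (i j : ℕ) (x y : MatSeq A) (n : ℕ) :
    entrySeq i j (x - y) n = entrySeq i j x n - entrySeq i j y n := by
  unfold entrySeq
  split_ifs
  · rfl
  · simp

theorem entrySeq_add (i j : ℕ) (x y : MatSeq A) (n : ℕ) :
    entrySeq i j (x + y) n = entrySeq i j x n + entrySeq i j y n := by
  unfold entrySeq
  split_ifs
  · rfl
  · simp

theorem entrySeq_smul (i j : ℕ) (c : ℂ) (x : MatSeq A) (n : ℕ) :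
    entrySeq i j (c • x) n = c • entrySeq i j x n := by
  unfold entrySeq
  split_ifs
  · rfl
  · simp

theorem exists_tendsto_entrySeq (i j : ℕ) (x : stableClosure A) :
    ∃ a : A, Tendsto (entrySeq i j (x : MatSeq A)) atTop (𝓝 a) := by
  apply cauchySeq_tendsto_of_complete
  rw [Metric.cauchySeq_iff']
  intro ε hε
  have hx : (x : MatSeq A) ∈ closure (stableSeq A : Set (MatSeq A)) := x.2
  obtain ⟨y, ⟨N, hN⟩, hxy⟩ := Metric.mem_closure_iff.mp hx (ε / 2) (half_pos hε)
  have hclose : ∀ n, ‖entrySeq i j (x : MatSeq A) n - entrySeq i j y n‖ < ε / 2 := fun n => by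
    rw [← entrySeq_sub]
    refine (norm_entrySeq_le i j _ n).trans_lt ?_
    refine (lp.norm_apply_le_norm ENNReal.top_ne_zero ((x : MatSeq A) - y) n).trans_lt ?_
    rwa [← dist_eq_norm]
  have hconst : ∀ n, max N (max i j + 1) ≤ n →
      entrySeq i j y n = entrySeq i j y (max N (max i j + 1)) := by
    intro n hn
    have hi : i < max N (max i j + 1) := by omega
    have hj : j < max N (max i j + 1) := by omega
    unfold entrySeq
    rw [dif_pos ⟨hi.trans_le hn, hj.trans_le hn⟩, dif_pos ⟨hi, hj⟩, hN n (by omega),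
      hN (max N (max i j + 1)) (by omega)]
    rfl
  refine ⟨max N (max i j + 1), fun n hn => ?_⟩
  rw [dist_eq_norm]
  have h1 := hclose n
  have h2 := hclose (max N (max i j + 1))
  rw [norm_sub_rev] at h2
  rw [hconst n hn] at h1
  calc _ = ‖(entrySeq i j (x : MatSeq A) n - entrySeq i j y (max N (max i j + 1))) +
        (entrySeq i j y (max N (max i j + 1)) -
          entrySeq i j (x : MatSeq A) (max N (max i j + 1)))‖ := by
        congr 1; abel
    _ ≤ _ := norm_add_le _ _
    _ < ε := by linarith

/-- The limit of the `(i, j)` entries. -/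
noncomputable def entryLim (i j : ℕ) : stableClosure A →ₗ[ℂ] A where
  toFun x := (exists_tendsto_entrySeq i j x).choose
  map_add' x y := by
    refine tendsto_nhds_unique (exists_tendsto_entrySeq i j (x + y)).choose_spec ?_
    exact ((exists_tendsto_entrySeq i j x).choose_spec.add
      (exists_tendsto_entrySeq i j y).choose_spec).congr fun n => (entrySeq_add i j _ _ n).symm
  map_smul' c x := by
    refine tendsto_nhds_unique (exists_tendsto_entrySeq i j (c • x)).choose_spec ?_
    exact ((exists_tendsto_entrySeq i j x).choose_spec.const_smul c).congr
      fun n => (entrySeq_smul i j c _ n).symm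

theorem tendsto_entryLim (i j : ℕ) (x : stableClosure A) :
    Tendsto (entrySeq i j (x : MatSeq A)) atTop (𝓝 (entryLim i j x)) :=
  (exists_tendsto_entrySeq i j x).choose_spec

/-- The entry `b_ij ∈ A` of `b = ∑ b_ij ⊗ e_ij ∈ A ⊗ 𝕂` (with indices starting at `0`). -/
noncomputable def Stab.entry (i j : ℕ) : Stab A →ₗ[ℂ] A :=
  Submodule.liftQ _ (entryLim i j) fun x hx => by
    have h0 : Tendsto (fun n => ‖(x : MatSeq A) n‖) atTop (𝓝 0) := hx
    exact tendsto_nhds_unique (tendsto_entryLim i j x)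
      (squeeze_zero_norm (norm_entrySeq_le i j _) h0)

theorem Stab.entry_stabMk (i j : ℕ) (x : stableClosure A) :
    Stab.entry i j (stabMk A x) = entryLim i j x := rfl

theorem Stab.entry_corner {N : ℕ} (x : MatAlg A N) (i j : Fin N) :
    Stab.entry i j (corner N x) = x.entry i j := by
  refine tendsto_nhds_unique (tendsto_entryLim (i : ℕ) (j : ℕ) _) ?_
  refine tendsto_const_nhds.congr' ?_
  filter_upwards [eventually_ge_atTop N] with M hM
  change _ = entrySeq i j (cornerSeq N x) M
  rw [entrySeq, dif_pos ⟨i.2.trans_le hM, j.2.trans_le hM⟩, cornerSeq_apply hM,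
    padHom_pos hM x ⟨i.2, j.2⟩]

/-- The diagonal entries of a positive element are positive. -/
theorem Stab.entry_nonneg (i : ℕ) {b : Stab A} (hb : 0 ≤ b) : 0 ≤ Stab.entry i i b := by
  obtain ⟨c, rfl⟩ := CStarAlgebra.nonneg_iff_eq_star_mul_self.mp hb
  obtain ⟨x, rfl⟩ := stabMk_surjective c
  rw [← map_star, ← map_mul, Stab.entry_stabMk]
  refine ge_of_tendsto' (tendsto_entryLim i i _) fun n => ?_
  unfold entrySeq
  split_ifs with h
  · change 0 ≤ (star ((x : MatSeq A) n) * (x : MatSeq A) n).entry ⟨i, h.1⟩ ⟨i, h.2⟩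
    rw [MatAlg.entry_mul]
    exact Finset.sum_nonneg fun k _ => star_mul_self_nonneg _
  · exact le_rfl

/-! ### The ⋆-homomorphism `F_ω(A) → F_ω(A ⊗ 𝕂)` -/

/-- The embedding `x ↦ x ⊗ 1_n` of `A` into `M_n(A)`. -/
noncomputable def diagHom (n : ℕ) : A →⋆ₙₐ[ℂ] MatAlg A n where
  toFun a := MatAlg.of fun i j => if i = j then a else 0
  map_smul' c a := by
    refine MatAlg.ext fun i j => ?_
    rw [MonoidHom.id_apply, MatAlg.entry_smul]
    simp only [MatAlg.entry_of]
    split_ifs <;> simp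
  map_zero' := by
    refine MatAlg.ext fun i j => ?_
    rw [MatAlg.entry_of, MatAlg.entry_zero, ite_self]
  map_add' a b := by
    refine MatAlg.ext fun i j => ?_
    rw [MatAlg.entry_add]
    simp only [MatAlg.entry_of]
    split_ifs <;> simp
  map_mul' a b := by
    refine MatAlg.ext fun i j => ?_
    rw [MatAlg.entry_mul]
    simp only [MatAlg.entry_of]
    simp
  map_star' a := by
    refine MatAlg.ext fun i j => ?_
    rw [MatAlg.entry_star]
    simp only [MatAlg.entry_of]
    by_cases h : i = j
    · rw [if_pos h, if_pos h.symm]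
    · rw [if_neg h, if_neg (Ne.symm h), star_zero]

theorem diagHom_entry (n : ℕ) (a : A) (i j : Fin n) :
    (diagHom n a).entry i j = if i = j then a else 0 := rfl

/-- The ⋆-homomorphism `A → A ⊗ 𝕂`, `x ↦ x ⊗ 1_n`, where `1_n = ∑_{i < n} e_ii`. -/
noncomputable def ampl (n : ℕ) : A →⋆ₙₐ[ℂ] Stab A := (corner n).comp (diagHom n)

theorem ampl_mul_corner {N n : ℕ} (h : N ≤ n) (x : A) (y : MatAlg A N) :
    ampl n x * corner N y = corner N (MatAlg.of fun i j => x * y.entry i j) := by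
  rw [← corner_padHom h y, ← corner_padHom h (MatAlg.of _), ampl, NonUnitalStarAlgHom.comp_apply,
    ← map_mul]
  congr 1
  refine MatAlg.ext fun i j => ?_
  rw [MatAlg.entry_mul]
  simp only [diagHom_entry, ite_mul, zero_mul, Finset.sum_ite_eq, Finset.mem_univ, if_true]
  by_cases hij : (i : ℕ) < N ∧ (j : ℕ) < N
  · rw [padHom_pos _ _ hij, padHom_pos _ _ hij, MatAlg.entry_of]
  · rw [padHom_neg _ _ hij, padHom_neg _ _ hij, mul_zero]

theorem corner_mul_ampl {N n : ℕ} (h : N ≤ n) (x : A) (y : MatAlg A N) :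
    corner N y * ampl n x = corner N (MatAlg.of fun i j => y.entry i j * x) := by
  rw [← corner_padHom h y, ← corner_padHom h (MatAlg.of _), ampl, NonUnitalStarAlgHom.comp_apply,
    ← map_mul]
  congr 1
  refine MatAlg.ext fun i j => ?_
  rw [MatAlg.entry_mul]
  simp only [diagHom_entry, mul_ite, mul_zero, Finset.sum_ite_eq', Finset.mem_univ, if_true]
  by_cases hij : (i : ℕ) < N ∧ (j : ℕ) < N
  · rw [padHom_pos _ _ hij, padHom_pos _ _ hij, MatAlg.entry_of]
  · rw [padHom_neg _ _ hij, padHom_neg _ _ hij, zero_mul]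

theorem MatAlg.tendsto_norm {ι : Type*} {l : Filter ι} {N : ℕ} {f : ι → MatAlg A N}
    (h : ∀ i j, Tendsto (fun n => ‖(f n).entry i j‖) l (𝓝 0)) :
    Tendsto (fun n => ‖f n‖) l (𝓝 0) := by
  rw [← tendsto_zero_iff_norm_tendsto_zero]
  have : Tendsto (fun n => (fun i j => (f n).entry i j : Fin N → Fin N → A)) l
      (𝓝 (0 : Fin N → Fin N → A)) := by
    rw [tendsto_pi_nhds]
    intro i
    rw [tendsto_pi_nhds]
    intro j
    exact tendsto_zero_iff_norm_tendsto_zero.mpr (h i j)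
  exact this

variable {ω : Ultrafilter ℕ}

variable (ω A) in
/-- The ⋆-homomorphism `Φ : A_ω → (A ⊗ 𝕂)_ω`, `(x_n) ↦ (x_n ⊗ 1_n)`. -/
noncomputable def ultraPhi : Ultrapower ω A →⋆ₙₐ[ℂ] Ultrapower ω (Stab A) :=
  CStarIdeal.lift _ ((ultraMk ω (Stab A)).comp (seqMap ampl)) fun x hx => by
    refine (CStarIdeal.toQuot_eq_zero _).mpr ?_
    rw [mem_nullIdeal] at hx ⊢
    exact squeeze_zero (fun n => norm_nonneg _)
      (fun n => NonUnitalStarAlgHom.norm_apply_le (ampl n) (x n)) hx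

theorem ultraPhi_ultraMk (u : BddSeq A) :
    ultraPhi A ω (ultraMk ω A u) = ultraMk ω (Stab A) (seqMap ampl u) := rfl

theorem ultraMk_eq_zero {B : Type*} [NonUnitalCStarAlgebra B] {u : BddSeq B} :
    ultraMk ω B u = 0 ↔ Tendsto (fun n => ‖u n‖) ω (𝓝 0) :=
  (CStarIdeal.toQuot_eq_zero _).trans mem_nullIdeal

theorem ultraMk_surjective (B : Type*) [NonUnitalCStarAlgebra B] :
    Function.Surjective (ultraMk ω B) := CStarIdeal.toQuot_surjective _

theorem ultraMk_const_mul {B : Type*} [NonUnitalCStarAlgebra B] (b : B) (u : BddSeq B) :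
    diagEmb ω B b * ultraMk ω B u =
      ultraMk ω B (seqOf (fun _ => NonUnitalStarAlgHom.id ℂ B) b * u) := by
  rw [map_mul]; rfl

theorem ultraMk_mul_const {B : Type*} [NonUnitalCStarAlgebra B] (b : B) (u : BddSeq B) :
    ultraMk ω B u * diagEmb ω B b =
      ultraMk ω B (u * seqOf (fun _ => NonUnitalStarAlgHom.id ℂ B) b) := by
  rw [map_mul]; rfl

theorem ultraPhi_mem_relComm (hω : (ω : Filter ℕ) ≤ cofinite) {x : Ultrapower ω A}
    (hx : x ∈ relComm ω A) : ultraPhi A ω x ∈ relComm ω (Stab A) := by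
  rw [mem_relComm] at hx ⊢
  intro b
  obtain ⟨u, rfl⟩ := ultraMk_surjective A x
  have hc : Continuous (diagEmb ω (Stab A)) := map_continuous _
  induction b using Stab.induction with
  | hp => exact isClosed_eq (by fun_prop) (by fun_prop)
  | h N y =>
    rw [ultraPhi_ultraMk, ultraMk_const_mul, ultraMk_mul_const, ← sub_eq_zero, ← map_sub,
      ultraMk_eq_zero]
    have key : Tendsto (fun n => ‖(MatAlg.of fun i j => y.entry i j * u n - u n * y.entry i j :
        MatAlg A N)‖) ω (𝓝 0) := by
      refine MatAlg.tendsto_norm fun i j => ?_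
      have := hx (y.entry i j)
      rw [ultraMk_const_mul, ultraMk_mul_const, ← sub_eq_zero, ← map_sub, ultraMk_eq_zero] at this
      exact this
    refine squeeze_zero' (Eventually.of_forall fun n => norm_nonneg _) ?_ key
    have hge : ∀ᶠ n in (ω : Filter ℕ), N ≤ n :=
      hω (by rw [Nat.cofinite_eq_atTop]; exact eventually_ge_atTop N)
    filter_upwards [hge] with n hn
    change ‖corner N y * ampl n (u n) - ampl n (u n) * corner N y‖ ≤ _
    rw [corner_mul_ampl hn, ampl_mul_corner hn, ← map_sub]
    exact NonUnitalStarAlgHom.norm_apply_le (corner N) _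

theorem ultraPhi_annihilates (hω : (ω : Filter ℕ) ≤ cofinite) {x : Ultrapower ω A}
    (hx : ∀ a : A, x * diagEmb ω A a = 0 ∧ diagEmb ω A a * x = 0) (b : Stab A) :
    ultraPhi A ω x * diagEmb ω (Stab A) b = 0 ∧ diagEmb ω (Stab A) b * ultraPhi A ω x = 0 := by
  obtain ⟨u, rfl⟩ := ultraMk_surjective A x
  have hc : Continuous (diagEmb ω (Stab A)) := map_continuous _
  have hge : ∀ N, ∀ᶠ n in (ω : Filter ℕ), N ≤ n := fun N =>
    hω (by rw [Nat.cofinite_eq_atTop]; exact eventually_ge_atTop N)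
  induction b using Stab.induction with
  | hp =>
    exact (isClosed_eq (by fun_prop) continuous_const).and
      (isClosed_eq (by fun_prop) continuous_const)
  | h N y =>
    rw [ultraPhi_ultraMk, ultraMk_const_mul, ultraMk_mul_const, ultraMk_eq_zero, ultraMk_eq_zero]
    constructor
    · have key : Tendsto (fun n => ‖(MatAlg.of fun i j => u n * y.entry i j :
          MatAlg A N)‖) ω (𝓝 0) := by
        refine MatAlg.tendsto_norm fun i j => ?_
        have := (hx (y.entry i j)).1
        rw [ultraMk_mul_const, ultraMk_eq_zero] at this
        exact this
      refine squeeze_zero' (Eventually.of_forall fun n => norm_nonneg _) ?_ key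
      filter_upwards [hge N] with n hn
      change ‖ampl n (u n) * corner N y‖ ≤ _
      rw [ampl_mul_corner hn]
      exact NonUnitalStarAlgHom.norm_apply_le (corner N) _
    · have key : Tendsto (fun n => ‖(MatAlg.of fun i j => y.entry i j * u n :
          MatAlg A N)‖) ω (𝓝 0) := by
        refine MatAlg.tendsto_norm fun i j => ?_
        have := (hx (y.entry i j)).2
        rw [ultraMk_const_mul, ultraMk_eq_zero] at this
        exact this
      refine squeeze_zero' (Eventually.of_forall fun n => norm_nonneg _) ?_ key
      filter_upwards [hge N] with n hn
      change ‖corner N y * ampl n (u n)‖ ≤ _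
      rw [corner_mul_ampl hn]
      exact NonUnitalStarAlgHom.norm_apply_le (corner N) _

variable (A) in
/-- The restriction of `Φ` to `A_ω ∩ A' → (A ⊗ 𝕂)_ω ∩ (A ⊗ 𝕂)'`. -/
noncomputable def commPhi (hω : (ω : Filter ℕ) ≤ cofinite) :
    relComm ω A →⋆ₙₐ[ℂ] relComm ω (Stab A) where
  toFun x := ⟨ultraPhi A ω x, ultraPhi_mem_relComm hω x.2⟩
  map_smul' c x := Subtype.ext (map_smul (ultraPhi A ω) c (x : Ultrapower ω A))
  map_zero' := Subtype.ext (map_zero (ultraPhi A ω))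
  map_add' x y := Subtype.ext (map_add (ultraPhi A ω) (x : Ultrapower ω A) y)
  map_mul' x y := Subtype.ext (map_mul (ultraPhi A ω) (x : Ultrapower ω A) y)
  map_star' x := Subtype.ext (map_star (ultraPhi A ω) (x : Ultrapower ω A))

variable (A) in
/-- The ⋆-homomorphism `Φ̄ : F_ω(A) → F_ω(A ⊗ 𝕂)` induced by `Φ`. -/
noncomputable def centralPhi (hω : (ω : Filter ℕ) ≤ cofinite) :
    CentralSeqAlg ω A →⋆ₙₐ[ℂ] CentralSeqAlg ω (Stab A) :=
  CStarIdeal.lift _ ((centralMk ω (Stab A)).comp (commPhi A hω)) fun _ hx =>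
    (CStarIdeal.toQuot_eq_zero _).mpr (ultraPhi_annihilates hω hx)

theorem centralPhi_centralMk (hω : (ω : Filter ℕ) ≤ cofinite) (x : relComm ω A) :
    centralPhi A hω (centralMk ω A x) = centralMk ω (Stab A) (commPhi A hω x) := rfl

variable (A) in
/-- `Φ̄` as a continuous linear map. -/
noncomputable def centralPhiL (hω : (ω : Filter ℕ) ≤ cofinite) :
    CentralSeqAlg ω A →L[ℂ] CentralSeqAlg ω (Stab A) where
  toLinearMap := (centralPhi A hω : CentralSeqAlg ω A →ₗ[ℂ] CentralSeqAlg ω (Stab A))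
  cont := map_continuous (centralPhi A hω)

end Stabilisation

/-! ## Traces -/

/-- A lower semicontinuous (extended) trace `B_+ → [0, ∞]`. -/
structure LSCTrace (B : Type*) [NonUnitalCStarAlgebra B] [PartialOrder B]
    [StarOrderedRing B] where
  toFun : {x : B // 0 ≤ x} → ℝ≥0∞
  map_zero' : toFun ⟨0, le_rfl⟩ = 0
  map_add' : ∀ x y : {x : B // 0 ≤ x},
    toFun ⟨x + y, add_nonneg x.2 y.2⟩ = toFun x + toFun y
  map_smul' : ∀ (c : ℝ) (hc : 0 < c) (x : {x : B // 0 ≤ x}),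
    toFun ⟨c • (x : B), smul_nonneg hc.le x.2⟩ = ENNReal.ofReal c * toFun x
  map_star_mul' : ∀ y : B,
    toFun ⟨star y * y, star_mul_self_nonneg y⟩ = toFun ⟨y * star y, mul_star_self_nonneg y⟩
  lsc' : LowerSemicontinuous toFun

section Traces

variable {B : Type*} [NonUnitalCStarAlgebra B] [PartialOrder B] [StarOrderedRing B]

/-- The cut-down `(x - ε)_+` of a positive element. -/
noncomputable def cutDown (ε : ℝ) (x : B) : B := cfcₙ (fun t : ℝ => max (t - ε) 0) x

theorem cutDown_nonneg (ε : ℝ) (x : B) : 0 ≤ cutDown ε x :=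
  cfcₙ_nonneg fun _ _ => le_max_right _ _

/-- The generalised limit trace on `ℓ^∞(B)_+` induced by a sequence of lower semicontinuous traces:
`τ(x) = sup_{ε > 0} lim_{n → ω} τ_n((x_n - ε)_+)`. -/
noncomputable def genLimSeq (ω : Ultrafilter ℕ) (τ : ℕ → LSCTrace B) (x : BddSeq B) : ℝ≥0∞ :=
  ⨆ (ε : ℝ) (_ : 0 < ε),
    limUnder (ω : Filter ℕ) fun n => (τ n).toFun ⟨cutDown ε (x n), cutDown_nonneg ε (x n)⟩

/-- The generalised limit trace induced on `(B_ω)_+`. All lifts of `q` to a positive element of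
`ℓ^∞(B)` give the same value, which is this infimum. -/
noncomputable def genLim (ω : Ultrafilter ℕ) (τ : ℕ → LSCTrace B) (q : Ultrapower ω B) : ℝ≥0∞ :=
  ⨅ (x : BddSeq B) (_ : ∀ n, 0 ≤ x n) (_ : ultraMk ω B x = q), genLimSeq ω τ x

/-- `φ` is the bounded trace `τ_b` on `F_ω(B)`, where `τ` is the generalised limit trace induced by
the sequence `τ`: a bounded positive linear functional with the trace property such that
`φ [x] = τ(b x)` for all positive `x` in `B_ω ∩ B'`. -/
structure IsInducedTrace (ω : Ultrafilter ℕ) (τ : ℕ → LSCTrace B) (b : B)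
    (φ : CentralSeqAlg ω B →L[ℂ] ℂ) : Prop where
  nonneg : ∀ y : CentralSeqAlg ω B, 0 ≤ y → 0 ≤ φ y
  trace : ∀ y z : CentralSeqAlg ω B, φ (y * z) = φ (z * y)
  apply_mk : ∀ x : relComm ω B, 0 ≤ (x : Ultrapower ω B) →
    genLim ω τ (diagEmb ω B b * x) = ENNReal.ofReal (φ (centralMk ω B x)).re

end Traces

section TensorTrace

variable {A : Type*} [NonUnitalCStarAlgebra A] [PartialOrder A] [StarOrderedRing A]

/-- `σ = τ ⊗ Tr`, i.e. `σ(∑ b_ij ⊗ e_ij) = ∑_i τ(b_ii)` on `(A ⊗ 𝕂)_+`. -/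
def IsTensorTr (σ : LSCTrace (Stab A)) (τ : LSCTrace A) : Prop :=
  ∀ b : {b : Stab A // 0 ≤ b},
    σ.toFun b = ∑' i : ℕ, τ.toFun ⟨Stab.entry i i b, Stab.entry_nonneg i b.2⟩

end TensorTrace

/-! The heart of the matter is a statement about one lower semicontinuous trace `ρ` on `A ⊗ 𝕂`: with
`ρ₀(x) = ρ(x ⊗ e_00)`, one has `ρ(b) = ∑ ρ₀(b_ii)` for every positive `b` (`LSCTrace.val_eq_tsum`).
For positive contractions `u` in `A`, the elements `b^{1/2} (u ⊗ 1_N) b^{1/2}` lie below `b` and can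
be chosen to approximate it in norm. The trace property moves each summand `b^{1/2} (u ⊗ e_ii)
b^{1/2}` to `u^{1/2} b_ii u^{1/2} ⊗ e_ii`, and from there to `b_ii^{1/2} u b_ii^{1/2}` in `A`, which
is at most `b_ii`. Lower semicontinuity removes `u` on both sides.

This formula is used three times. Applied to `σ_n`, it shows that `τ_n = σ_n(· ⊗ e_00)` satisfies
`σ_n = τ_n ⊗ Tr`; uniqueness follows by testing on `x ⊗ e_00`. Applied to `b ↦ σ(b)`, it gives `σ(a)
= ∑ τ(a_ii)`, hence finiteness of every `τ(a_ii)`. Applied to `b ↦ σ(b Φ(x))`, which is again a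
lower semicontinuous trace because `Φ(x)` is positive and commutes with `A ⊗ 𝕂`, it gives `σ(a Φ(x))
= ∑ τ(a_ii x)`. The last two uses need `(d ⊗ e_00) Φ(x) = d x ⊗ e_00` and the fact that the limit
trace is itself a lower semicontinuous trace on the ultrapower (`genLimTrace`). That fact rests on
comparisons of the cut-downs `(x - ε)_+` in which a small loss in `ε` is absorbed by the supremum
over `ε`.

Finally, `x ↦ τ(b x)` is additive on positive elements and bounded by `τ(b) ‖x‖`, so it extends to a
bounded trace on `F_ω`, determined by its values on the positive cone. The bound `‖τ_{a_ii}‖ ≤ 4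
τ(a_ii)` makes the series absolutely convergent, and its sum is identified on positive elements. -/

/-! ## Inequalities for a single trace -/

section SingleTrace

variable {B : Type*} [NonUnitalCStarAlgebra B] [PartialOrder B] [StarOrderedRing B]

namespace LSCTrace

open Classical in
/-- The value of a trace at `x`, which is `∞` if `x` is not positive. -/
noncomputable def val (τ : LSCTrace B) (x : B) : ℝ≥0∞ := if h : 0 ≤ x then τ.toFun ⟨x, h⟩ else ∞

variable (τ : LSCTrace B)

theorem val_of_nonneg {x : B} (hx : 0 ≤ x) : τ.val x = τ.toFun ⟨x, hx⟩ := dif_pos hx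

theorem val_zero : τ.val 0 = 0 := by rw [τ.val_of_nonneg le_rfl, τ.map_zero']

theorem val_add {x y : B} (hx : 0 ≤ x) (hy : 0 ≤ y) : τ.val (x + y) = τ.val x + τ.val y := by
  rw [τ.val_of_nonneg hx, τ.val_of_nonneg hy, τ.val_of_nonneg (add_nonneg hx hy)]
  exact τ.map_add' ⟨x, hx⟩ ⟨y, hy⟩

theorem val_smul {c : ℝ} (hc : 0 ≤ c) {x : B} (hx : 0 ≤ x) :
    τ.val (c • x) = ENNReal.ofReal c * τ.val x := by
  rcases hc.eq_or_lt with rfl | hc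
  · simp [τ.val_zero]
  · rw [τ.val_of_nonneg hx, τ.val_of_nonneg (smul_nonneg hc.le hx)]
    exact τ.map_smul' c hc ⟨x, hx⟩

theorem val_star_mul (y : B) : τ.val (star y * y) = τ.val (y * star y) := by
  rw [τ.val_of_nonneg (star_mul_self_nonneg y), τ.val_of_nonneg (mul_star_self_nonneg y)]
  exact τ.map_star_mul' y

theorem val_sum {ι : Type*} (s : Finset ι) (f : ι → B) (hf : ∀ i ∈ s, 0 ≤ f i) :
    τ.val (∑ i ∈ s, f i) = ∑ i ∈ s, τ.val (f i) := by
  classical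
  induction s using Finset.induction_on with
  | empty => simp [τ.val_zero]
  | insert i s hi ih =>
    rw [Finset.sum_insert hi, Finset.sum_insert hi,
      τ.val_add (hf i (Finset.mem_insert_self i s))
        (Finset.sum_nonneg fun j hj => hf j (Finset.mem_insert_of_mem hj)),
      ih fun j hj => hf j (Finset.mem_insert_of_mem hj)]

theorem val_mono {x y : B} (hx : 0 ≤ x) (h : x ≤ y) : τ.val x ≤ τ.val y := by
  have := τ.val_add hx (sub_nonneg.mpr h)
  rw [add_sub_cancel] at this
  rw [this]
  exact le_self_add

theorem ext_val {τ τ' : LSCTrace B} (h : ∀ x, 0 ≤ x → τ.val x = τ'.val x) : τ = τ' := by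
  have : τ.toFun = τ'.toFun := by
    funext ⟨x, hx⟩
    rw [← τ.val_of_nonneg hx, ← τ'.val_of_nonneg hx, h x hx]
  cases τ; cases τ'; congr

/-- Sublevel sets of a lower semicontinuous trace are closed. -/
theorem val_le_of_tendsto {ι : Type*} {l : Filter ι} [l.NeBot] {f : ι → B} {x : B} {r : ℝ≥0∞}
    (hf : ∀ᶠ i in l, 0 ≤ f i ∧ τ.val (f i) ≤ r) (h : Tendsto f l (𝓝 x)) : τ.val x ≤ r := by
  -- Lower semicontinuity makes the sublevel set closed relative to the positive cone; the cone is
  -- itself closed in `B`.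
  have hcl : IsClosed {y : B | 0 ≤ y ∧ τ.val y ≤ r} := by
    have h1 := (τ.lsc'.isClosed_preimage r)
    have h2 := (CStarAlgebra.isClosed_nonneg (A := B)).isClosedEmbedding_subtypeVal.isClosedMap _ h1
    convert h2 using 1
    ext y
    constructor
    · rintro ⟨hy, hyr⟩
      exact ⟨⟨y, hy⟩, by rwa [τ.val_of_nonneg hy] at hyr, rfl⟩
    · rintro ⟨⟨y, hy⟩, hyr, rfl⟩
      exact ⟨hy, by rwa [τ.val_of_nonneg hy]⟩
  exact (hcl.mem_of_tendsto h hf).2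

/-- The pinching inequality `τ(h y h) ≤ τ(y)` for self-adjoint contractions. -/
theorem val_conjugate_le {h y : B} (hh : IsSelfAdjoint h) (h1 : ‖h * h‖ ≤ 1) (hy : 0 ≤ y) :
    τ.val (h * y * h) ≤ τ.val y := by
  have hs := CFC.sqrt_nonneg y
  have hss := (IsSelfAdjoint.of_nonneg hs).star_eq
  have hy' := CFC.sqrt_mul_sqrt_self y
  set s := CFC.sqrt y
  -- The trace property exchanges `(hs)(hs)*` for `s h² s`, which is at most `‖h²‖ s² ≤ y`.
  have e1 : h * y * h = (h * s) * star (h * s) := by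
    rw [star_mul, hss, hh.star_eq, ← hy']; noncomm_ring
  have e2 : star (h * s) * (h * s) = star s * (h * h) * s := by
    rw [star_mul, hh.star_eq]; noncomm_ring
  rw [e1, ← τ.val_star_mul, e2]
  refine τ.val_mono ?_ ?_
  · rw [← e2]; exact star_mul_self_nonneg _
  · have hsa : IsSelfAdjoint (h * h) := by
      have := IsSelfAdjoint.mul_star_self h
      rwa [hh.star_eq] at this
    refine (CStarAlgebra.star_left_conjugate_le_norm_smul hsa).trans ?_
    rw [hss, hy']
    calc ‖h * h‖ • y ≤ (1 : ℝ) • y := smul_le_smul_of_nonneg_right h1 hy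
      _ = y := one_smul _ _

end LSCTrace

/-! ### Functional calculus for cut-downs. -/

theorem cfcₙ_mul_self_mul {x : B} (hx : IsSelfAdjoint x) {f : ℝ → ℝ} (hf : Continuous f)
    (hf0 : f 0 = 0) : cfcₙ f x * x * cfcₙ f x = cfcₙ (fun t => f t * t * f t) x := by
  conv_lhs => enter [1, 2]; rw [← cfcₙ_id' ℝ x hx]
  rw [← cfcₙ_mul f (fun t => t) x hf.continuousOn hf0, ← cfcₙ_mul (fun t => f t * t) f x
    (by fun_prop) (by simp) hf.continuousOn hf0]

theorem norm_sub_cutDown_le {x : B} (hx : 0 ≤ x) {ε : ℝ} (hε : 0 ≤ ε) : ‖x - cutDown ε x‖ ≤ ε := by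
  have hsa := IsSelfAdjoint.of_nonneg hx
  have : x - cutDown ε x = cfcₙ (fun t : ℝ => t - max (t - ε) 0) x := by
    rw [cfcₙ_sub (fun t : ℝ => t) _ x (by fun_prop) rfl (by fun_prop) (by simp [hε]),
      cfcₙ_id' ℝ x hsa, cutDown]
  rw [this]
  refine norm_cfcₙ_le fun t ht => ?_
  have ht0 : 0 ≤ t := quasispectrum_nonneg_of_nonneg x hx t ht
  rw [Real.norm_eq_abs, abs_le]
  rcases le_total (t - ε) 0 with h | h
  · rw [max_eq_right h]; constructor <;> linarith
  · rw [max_eq_left h]; constructor <;> linarith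

theorem cutDown_zero (ε : ℝ) : cutDown ε (0 : B) = 0 := cfcₙ_apply_zero

theorem cutDown_antitone (x : B) {δ ε : ℝ} (hδ : 0 ≤ δ) (h : δ ≤ ε) : cutDown ε x ≤ cutDown δ x :=
  cfcₙ_mono (fun t _ => max_le_max (by linarith) le_rfl) (by fun_prop) (by fun_prop)
    (by simp [hδ.trans h]) (by simp [hδ])

theorem cutDown_smul {x : B} (hx : 0 ≤ x) {c : ℝ} (hc : 0 < c) {ε : ℝ} (hε : 0 ≤ ε) :
    cutDown (c * ε) (c • x) = c • cutDown ε x := by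
  have hsa := IsSelfAdjoint.of_nonneg hx
  rw [cutDown, ← cfcₙ_comp_smul c _ x (by fun_prop) (by simp; positivity) hsa, cutDown,
    ← cfcₙ_smul c _ x (by fun_prop) (by simp [hε])]
  congr 1
  funext t
  rw [smul_eq_mul, smul_eq_mul, mul_max_of_nonneg _ _ hc.le, mul_sub, mul_zero]

theorem map_cutDown {C : Type*} [NonUnitalCStarAlgebra C] [PartialOrder C] [StarOrderedRing C]
    (f : B →⋆ₙₐ[ℂ] C) {x : B} (hx : 0 ≤ x) {ε : ℝ} (hε : 0 ≤ ε) :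
    f (cutDown ε x) = cutDown ε (f x) := by
  have hsa := IsSelfAdjoint.of_nonneg hx
  exact NonUnitalStarAlgHomClass.map_cfcₙ (S := ℂ) f _ x (by fun_prop) (by simp [hε]) (map_continuous f) hsa (hsa.map f)

namespace LSCTrace

variable (τ : LSCTrace B)

/-- There is a self-adjoint contraction `k` with `(x - ε)_+ ≤ k y k`, so the conjugation inequality
applies. With `δ = ‖x - y‖`, formally `x - δ ≤ y`, and `k` is a function of `x` chosen such that `k
(x - δ) k = (x - ε)_+`. This is the source of all perturbation estimates below. -/
theorem val_cutDown_le {x y : B} (hx : 0 ≤ x) (hy : 0 ≤ y) {ε : ℝ} (h : ‖x - y‖ < ε) :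
    τ.val (cutDown ε x) ≤ τ.val y := by
  have hsa := IsSelfAdjoint.of_nonneg hx
  set δ := ‖x - y‖ with hδ
  have hδ0 : 0 ≤ δ := norm_nonneg _
  have hpos : ∀ t : ℝ, 0 < max (t - δ) (ε - δ) := fun t => lt_max_of_lt_right (sub_pos.mpr h)
  -- The requirement is `f(t)² (t - δ) = (t - ε)_+`. The floor `ε - δ` only keeps the denominator
  -- positive: it is active for `t ≤ ε`, where the numerator vanishes.
  let f : ℝ → ℝ := fun t => √(max (t - ε) 0 / max (t - δ) (ε - δ))
  have hfc : Continuous f := Real.continuous_sqrt.comp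
    (Continuous.div (by fun_prop) (by fun_prop) fun t => (hpos t).ne')
  have hf0 : f 0 = 0 := by simp [f, hδ0.trans h.le]
  have hff : ∀ t, f t * f t = max (t - ε) 0 / max (t - δ) (ε - δ) := fun t =>
    Real.mul_self_sqrt (div_nonneg (le_max_right _ _) (hpos t).le)
  set k := cfcₙ f x with hk
  have hks : IsSelfAdjoint k := cfcₙ_predicate f x
  have hkk : k * k = cfcₙ (fun t => f t * f t) x :=
    (cfcₙ_mul f f x hfc.continuousOn hf0 hfc.continuousOn hf0).symm
  -- Since `B` need not have a unit, `k (x - δ) k` is written as `k x k - δ k²`.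
  have e1 : cutDown ε x = k * x * k - δ • (k * k) := by
    rw [hk, cfcₙ_mul_self_mul hsa hfc hf0, ← hk, hkk, ← cfcₙ_smul δ _ x (by fun_prop) (by simp [hf0]),
      ← cfcₙ_sub _ _ x (by fun_prop) (by simp) (by fun_prop) (by simp [hf0]), cutDown]
    congr 1
    funext t
    have : f t * t * f t - δ • (f t * f t) = (f t * f t) * (t - δ) := by rw [smul_eq_mul]; ring
    rw [this, hff]
    rcases le_total t ε with ht | ht
    · rw [max_eq_right (sub_nonpos.mpr ht)]; simp
    · rw [max_eq_left (b := ε - δ) (by linarith)]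
      field_simp [show t - δ ≠ 0 by linarith]
  have hle : cutDown ε x ≤ k * y * k := by
    have := CStarAlgebra.star_left_conjugate_le_norm_smul (a := k)
      (hsa.sub (IsSelfAdjoint.of_nonneg hy))
    rw [hks.star_eq, ← hδ, mul_sub, sub_mul] at this
    rw [e1]
    rw [sub_le_iff_le_add] at this ⊢
    rwa [add_comm]
  refine (τ.val_mono (cutDown_nonneg ε x) hle).trans (τ.val_conjugate_le hks ?_ hy)
  rw [hkk]
  refine norm_cfcₙ_le fun t _ => ?_
  rw [Real.norm_of_nonneg (mul_self_nonneg _), hff]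
  refine div_le_one_of_le₀ (max_le ?_ (hpos t).le) (hpos t).le
  exact le_max_of_le_left (by linarith)

theorem val_cutDown_add_le {x y : B} (hx : 0 ≤ x) (hy : 0 ≤ y) {ε δ : ℝ} (hε : 0 ≤ ε)
    (h : ‖x - y‖ < δ) : τ.val (cutDown (ε + δ) x) ≤ τ.val (cutDown ε y) := by
  refine τ.val_cutDown_le hx (cutDown_nonneg _ _) ?_
  have := norm_add_le (x - y) (y - cutDown ε y)
  rw [sub_add_sub_cancel] at this
  linarith [norm_sub_cutDown_le hy hε]

/-- If `y⋆y ≤ z`, there is a self-adjoint `h` with `h z h = (z - δ)_+` such that `y h² y⋆` is close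
to `y y⋆`. -/
theorem exists_compression {z : B} (hz : 0 ≤ z) {δ : ℝ} (hδ : 0 < δ) :
    ∃ h : B, IsSelfAdjoint h ∧ h * z * h = cutDown δ z ∧ ∀ (τ : LSCTrace B) (y : B) (ε : ℝ),
      star y * y ≤ z → δ < ε → τ.val (cutDown ε (y * star y)) ≤ τ.val (h * (star y * y) * h) := by
  have hsa := IsSelfAdjoint.of_nonneg hz
  have hpos : ∀ t : ℝ, 0 < max t δ := fun t => lt_max_of_lt_right hδ
  -- Here `f(t)² t = (t - δ)_+` for all `t`, and `1 - f² = δ / max(t, δ) = (1 - g)²`. So formally `k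
  -- = 1 - (1 - h²)^{1/2}`; as `g(0) = 0`, this `k` lies in `B` even without a unit.
  let f : ℝ → ℝ := fun t => √(max (t - δ) 0 / max t δ)
  let g : ℝ → ℝ := fun t => 1 - √(δ / max t δ)
  have hfc : Continuous f := Real.continuous_sqrt.comp
    (Continuous.div (by fun_prop) (by fun_prop) fun t => (hpos t).ne')
  have hgc : Continuous g := continuous_const.sub (Real.continuous_sqrt.comp
    (Continuous.div (by fun_prop) (by fun_prop) fun t => (hpos t).ne'))
  have hf0 : f 0 = 0 := by simp [f, hδ.le]
  have hg0 : g 0 = 0 := by simp [g, hδ.le, hδ.ne']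
  have hff : ∀ t, f t * f t = max (t - δ) 0 / max t δ := fun t =>
    Real.mul_self_sqrt (div_nonneg (le_max_right _ _) (hpos t).le)
  have hgg : ∀ t, (1 - g t) * (1 - g t) = δ / max t δ := fun t => by
    simp only [g, sub_sub_cancel]
    exact Real.mul_self_sqrt (div_nonneg hδ.le (hpos t).le)
  set h := cfcₙ f z with hh
  set k := cfcₙ g z with hk
  have hhs : IsSelfAdjoint h := cfcₙ_predicate f z
  have hks : IsSelfAdjoint k := cfcₙ_predicate g z
  have hkh : k + k - k * k = h * h := by
    rw [hh, hk, ← cfcₙ_mul f f z hfc.continuousOn hf0 hfc.continuousOn hf0,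
      ← cfcₙ_mul g g z hgc.continuousOn hg0 hgc.continuousOn hg0,
      ← cfcₙ_add g g z hgc.continuousOn hg0 hgc.continuousOn hg0,
      ← cfcₙ_sub _ _ z (by fun_prop) (by simp [hg0]) (by fun_prop) (by simp [hg0])]
    congr 1
    funext t
    have e : g t + g t - g t * g t = 1 - (1 - g t) * (1 - g t) := by ring
    rw [e, hff, hgg]
    rcases le_total t δ with ht | ht
    · rw [max_eq_right (sub_nonpos.mpr ht), max_eq_right ht]; field_simp; simp
    · rw [max_eq_left (sub_nonneg.mpr ht), max_eq_left ht]
      field_simp [show t ≠ 0 by linarith]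
  refine ⟨h, hhs, ?_, fun τ y ε hyz hε => ?_⟩
  · rw [hh, cfcₙ_mul_self_mul hsa hfc hf0, cutDown]
    congr 1
    funext t
    have : f t * t * f t = (f t * f t) * t := by ring
    rw [this, hff]
    rcases le_total t δ with ht | ht
    · rw [max_eq_right (sub_nonpos.mpr ht)]; simp
    · rw [max_eq_left ht]
      field_simp [show t ≠ 0 by linarith]
  -- The element is `(1 - k) z (1 - k)`, corresponding to the function `δ t / max(t, δ) ≤ δ` for `t
  -- ≥ 0`.
  · have hnorm : ‖z - k * z - z * k + k * z * k‖ ≤ δ := by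
      have hz' : z = cfcₙ (fun t : ℝ => t) z := (cfcₙ_id' ℝ z hsa).symm
      have : z - k * z - z * k + k * z * k = cfcₙ (fun t : ℝ => t - g t * t - t * g t + g t * t * g t) z := by
        rw [cfcₙ_add _ _ z (by fun_prop) (by simp) (by fun_prop) (by simp),
          cfcₙ_sub _ _ z (by fun_prop) (by simp) (by fun_prop) (by simp),
          cfcₙ_sub _ _ z (by fun_prop) (by simp) (by fun_prop) (by simp),
          cfcₙ_mul g (fun t => t) z (by fun_prop) hg0 (by fun_prop) (by simp),
          cfcₙ_mul (fun t => t) g z (by fun_prop) rfl (by fun_prop) hg0,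
          ← cfcₙ_mul_self_mul hsa hgc hg0, ← hz']
      rw [this]
      refine norm_cfcₙ_le fun t ht => ?_
      have ht0 : 0 ≤ t := quasispectrum_nonneg_of_nonneg z hz t ht
      have e : t - g t * t - t * g t + g t * t * g t = ((1 - g t) * (1 - g t)) * t := by ring
      rw [e, hgg, Real.norm_of_nonneg (mul_nonneg (div_nonneg hδ.le (hpos t).le) ht0),
        div_mul_eq_mul_div]
      exact div_le_of_le_mul₀ (hpos t).le hδ.le (mul_le_mul_of_nonneg_left (le_max_left _ _) hδ.le)
    -- Formally `w = y (1 - h²)^{1/2}`. Hence `w w* = y y* - y h² y*`, while `w* w ≤ (1 - k) z (1 -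
    -- k)` because `y* y ≤ z`. The two products have equal norm, so `y h² y*` is within `δ` of `y
    -- y*`.
    set w := y - y * k with hw
    have hww : star w * w ≤ z - k * z - z * k + k * z * k := by
      obtain ⟨r, hr⟩ := CStarAlgebra.nonneg_iff_eq_star_mul_self.mp (sub_nonneg.mpr hyz)
      have hzr : z = star y * y + star r * r := by rw [← hr]; abel
      have e : z - k * z - z * k + k * z * k - star w * w = star (r - r * k) * (r - r * k) := by
        rw [hw, hzr]
        simp only [star_sub, star_mul, hks.star_eq]
        noncomm_ring
      rw [← sub_nonneg, e]
      exact star_mul_self_nonneg _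
    have hwn : ‖w * star w‖ ≤ δ := by
      rw [CStarRing.norm_self_mul_star, ← CStarRing.norm_star_mul_self]
      exact (CStarAlgebra.norm_le_norm_of_nonneg_of_le (star_mul_self_nonneg w) hww).trans hnorm
    have e1 : w * star w = y * star y - y * h * star (y * h) := by
      have : y * h * star (y * h) = y * (h * h) * star y := by
        rw [star_mul, hhs.star_eq]; noncomm_ring
      rw [this, ← hkh, hw]
      simp only [star_sub, star_mul, hks.star_eq]
      noncomm_ring
    have e2 : star (y * h) * (y * h) = h * (star y * y) * h := by
      rw [star_mul, hhs.star_eq]; noncomm_ring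
    rw [← e2, τ.val_star_mul]
    refine τ.val_cutDown_le (mul_star_self_nonneg y) (mul_star_self_nonneg _) ?_
    rw [← e1]
    exact hwn.trans_lt hε

/-- The compression for `z = y* y`. The gap between `δ` and `ε` costs nothing once the supremum over
cut-downs is taken, and this yields the trace property of the limit trace. -/
theorem val_cutDown_mul_star_le (y : B) {δ ε : ℝ} (hδ : 0 < δ) (h : δ < ε) :
    τ.val (cutDown ε (y * star y)) ≤ τ.val (cutDown δ (star y * y)) := by
  obtain ⟨k, _, hk, H⟩ := exists_compression (star_mul_self_nonneg y) hδ
  rw [← hk]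
  exact H τ y ε le_rfl h

/-- A single compressing element `k` for `z = x + y` serves both `x^{1/2}` and `y^{1/2}`, and `k x k
+ k y k = (x + y - δ)_+`. This is the superadditive half of additivity for the limit trace. -/
theorem val_cutDown_add_val_cutDown_le {x y : B} (hx : 0 ≤ x) (hy : 0 ≤ y) {δ ε : ℝ}
    (hδ : 0 < δ) (h : δ < ε) :
    τ.val (cutDown ε x) + τ.val (cutDown ε y) ≤ τ.val (cutDown δ (x + y)) := by
  obtain ⟨k, hks, hk, H⟩ := exists_compression (add_nonneg hx hy) hδ
  have key : ∀ w : B, 0 ≤ w → w ≤ x + y → τ.val (cutDown ε w) ≤ τ.val (k * w * k) := by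
    intro w hw hwle
    have hs := (IsSelfAdjoint.of_nonneg (CFC.sqrt_nonneg w)).star_eq
    have hw' := CFC.sqrt_mul_sqrt_self w
    have := H τ (CFC.sqrt w) ε (by rw [hs, hw']; exact hwle) h
    rwa [hs, hw'] at this
  have hconj : ∀ w : B, 0 ≤ w → 0 ≤ k * w * k := fun w hw => by
    have := star_left_conjugate_nonneg hw k
    rwa [hks.star_eq] at this
  refine (add_le_add (key x hx (le_add_of_nonneg_right hy))
    (key y hy (le_add_of_nonneg_left hx))).trans ?_
  rw [← τ.val_add (hconj x hx) (hconj y hy), ← hk, mul_add, add_mul]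

/-- The sum of the two cut-downs is within `2ε < 3ε` of `x + y`. This is the subadditive half. -/
theorem val_cutDown_add_le_add {x y : B} (hx : 0 ≤ x) (hy : 0 ≤ y) {ε : ℝ} (hε : 0 < ε) :
    τ.val (cutDown (3 * ε) (x + y)) ≤ τ.val (cutDown ε x) + τ.val (cutDown ε y) := by
  rw [← τ.val_add (cutDown_nonneg _ _) (cutDown_nonneg _ _)]
  refine τ.val_cutDown_le (add_nonneg hx hy)
    (add_nonneg (cutDown_nonneg _ _) (cutDown_nonneg _ _)) ?_
  rw [add_sub_add_comm]
  have := norm_add_le (x - cutDown ε x) (y - cutDown ε y)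
  linarith [norm_sub_cutDown_le hx hε.le, norm_sub_cutDown_le hy hε.le]

end LSCTrace

end SingleTrace

/-! ## The generalised limit trace -/

section GenLim

variable {B : Type*} [NonUnitalCStarAlgebra B] {ω : Ultrafilter ℕ}

theorem exists_nonneg_lift {q : Ultrapower ω B} (hq : 0 ≤ q) :
    ∃ v : BddSeq B, ultraMk ω B (star v * v) = q := by
  obtain ⟨p, rfl⟩ := CStarAlgebra.nonneg_iff_eq_star_mul_self.mp hq
  obtain ⟨v, rfl⟩ := ultraMk_surjective B p
  exact ⟨v, by rw [map_mul, map_star]⟩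

theorem ultraMk_eq_of_eventuallyEq {u v : BddSeq B} (h : ∀ᶠ n in (ω : Filter ℕ), u n = v n) :
    ultraMk ω B u = ultraMk ω B v := by
  rw [← sub_eq_zero, ← map_sub, ultraMk_eq_zero]
  refine tendsto_const_nhds.congr' ?_
  filter_upwards [h] with n hn
  rw [lp.coeFn_sub, Pi.sub_apply, hn, sub_self, norm_zero]

/-- The class of `x - y` has a representative `w` of norm below `δ`, and `x - y - w` tends to zero
along `ω`. This passes from the quotient norm to coordinatewise estimates. -/
theorem eventually_norm_apply_sub_lt {x y : BddSeq B} {δ : ℝ}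
    (h : ‖ultraMk ω B x - ultraMk ω B y‖ < δ) : ∀ᶠ n in (ω : Filter ℕ), ‖x n - y n‖ < δ := by
  rw [← map_sub] at h
  obtain ⟨w, hw, hwn⟩ := (nullIdeal (ω : Filter ℕ) (fun _ : ℕ => B)).exists_norm_lt
    (ultraMk ω B (x - y)) (half_pos (sub_pos.mpr h))
  have h0 : ultraMk ω B (x - y - w) = 0 := by
    rw [map_sub, sub_eq_zero]; exact hw.symm
  rw [ultraMk_eq_zero] at h0
  filter_upwards [(Metric.tendsto_nhds.mp h0) _ (half_pos (sub_pos.mpr h))] with n hn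
  rw [dist_zero_right, norm_norm] at hn
  have h1 : ‖w n‖ ≤ ‖w‖ := lp.norm_apply_le_norm ENNReal.top_ne_zero w n
  have h2 : x n - y n = (x - y - w) n + w n := by simp
  rw [h2]
  refine (norm_add_le _ _).trans_lt ?_
  linarith

variable [PartialOrder B] [StarOrderedRing B]

theorem ultraMk_nonneg {u : BddSeq B} (hu : ∀ n, 0 ≤ u n) : 0 ≤ ultraMk ω B u := by
  let v : BddSeq B := ⟨fun n => CFC.sqrt (u n), memℓp_infty ⟨√‖u‖, by
    rintro _ ⟨n, rfl⟩
    change ‖CFC.sqrt (u n)‖ ≤ _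
    rw [CFC.norm_sqrt _ (hu n)]
    exact Real.sqrt_le_sqrt (lp.norm_apply_le_norm ENNReal.top_ne_zero u n)⟩⟩
  have : u = star v * v := lp.ext (funext fun n => by
    change u n = star (CFC.sqrt (u n)) * CFC.sqrt (u n)
    rw [(IsSelfAdjoint.of_nonneg (CFC.sqrt_nonneg (u n))).star_eq,
      CFC.sqrt_mul_sqrt_self _ (hu n)])
  rw [this, map_mul, map_star]
  exact star_mul_self_nonneg _

variable (ω) in
/-- `lim_{n → ω} τ_n((x_n - ε)_+)`. -/
noncomputable def cutLim (τ : ℕ → LSCTrace B) (ε : ℝ) (x : BddSeq B) : ℝ≥0∞ :=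
  limUnder (ω : Filter ℕ) fun n => (τ n).val (cutDown ε (x n))

/-- `[0, ∞]` is compact, so limits along an ultrafilter exist and `limUnder` is a genuine limit, not
a default value. -/
theorem tendsto_cutLim (τ : ℕ → LSCTrace B) (ε : ℝ) (x : BddSeq B) :
    Tendsto (fun n => (τ n).val (cutDown ε (x n))) ω (𝓝 (cutLim ω τ ε x)) :=
  tendsto_nhds_limUnder ⟨_, (ω.map fun n => (τ n).val (cutDown ε (x n))).le_nhds_lim⟩

theorem genLimSeq_eq (τ : ℕ → LSCTrace B) (x : BddSeq B) :
    genLimSeq ω τ x = ⨆ (ε : ℝ) (_ : 0 < ε), cutLim ω τ ε x := by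
  simp only [genLimSeq, cutLim, (τ _).val_of_nonneg (cutDown_nonneg _ _)]

theorem cutLim_le_genLimSeq (τ : ℕ → LSCTrace B) {ε : ℝ} (hε : 0 < ε) (x : BddSeq B) :
    cutLim ω τ ε x ≤ genLimSeq ω τ x := by
  rw [genLimSeq_eq]
  exact le_iSup₂_of_le ε hε le_rfl

theorem cutLim_mono {C : Type*} [NonUnitalCStarAlgebra C] [PartialOrder C] [StarOrderedRing C]
    {τ : ℕ → LSCTrace B} {ρ : ℕ → LSCTrace C} {x : BddSeq B} {y : BddSeq C} {ε δ : ℝ}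
    (h : ∀ᶠ n in (ω : Filter ℕ), (τ n).val (cutDown ε (x n)) ≤ (ρ n).val (cutDown δ (y n))) :
    cutLim ω τ ε x ≤ cutLim ω ρ δ y :=
  le_of_tendsto_of_tendsto (tendsto_cutLim τ ε x) (tendsto_cutLim ρ δ y) h

theorem genLimSeq_mono {C : Type*} [NonUnitalCStarAlgebra C] [PartialOrder C] [StarOrderedRing C]
    {τ : ℕ → LSCTrace B} {ρ : ℕ → LSCTrace C} {x : BddSeq B} {y : BddSeq C}
    (h : ∀ ε : ℝ, 0 < ε → ∃ δ : ℝ, 0 < δ ∧ ∀ᶠ n in (ω : Filter ℕ),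
      (τ n).val (cutDown ε (x n)) ≤ (ρ n).val (cutDown δ (y n))) :
    genLimSeq ω τ x ≤ genLimSeq ω ρ y := by
  rw [genLimSeq_eq]
  refine iSup₂_le fun ε hε => ?_
  obtain ⟨δ, hδ, hn⟩ := h ε hε
  exact (cutLim_mono hn).trans (cutLim_le_genLimSeq ρ hδ y)

theorem cutLim_le_of_norm_sub_lt (τ : ℕ → LSCTrace B) {x y : BddSeq B} (hx : ∀ n, 0 ≤ x n)
    (hy : ∀ n, 0 ≤ y n) {ε δ : ℝ} (hε : 0 ≤ ε) (h : ‖ultraMk ω B x - ultraMk ω B y‖ < δ) :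
    cutLim ω τ (ε + δ) x ≤ cutLim ω τ ε y := by
  refine cutLim_mono ?_
  filter_upwards [eventually_norm_apply_sub_lt h] with n hn
  exact (τ n).val_cutDown_add_le (hx n) (hy n) hε hn

/-- Cutting one lift at `ε` is dominated by cutting the other at `ε / 2`, so the supremum does not
see the choice of positive lift. -/
theorem genLimSeq_congr (τ : ℕ → LSCTrace B) {x y : BddSeq B} (hx : ∀ n, 0 ≤ x n)
    (hy : ∀ n, 0 ≤ y n) (h : ultraMk ω B x = ultraMk ω B y) :
    genLimSeq ω τ x = genLimSeq ω τ y := by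
  have key : ∀ x y : BddSeq B, (∀ n, 0 ≤ x n) → (∀ n, 0 ≤ y n) → ultraMk ω B x = ultraMk ω B y →
      genLimSeq ω τ x ≤ genLimSeq ω τ y := by
    intro x y hx hy h
    rw [genLimSeq_eq]
    refine iSup₂_le fun ε hε => ?_
    have h0 : ‖ultraMk ω B x - ultraMk ω B y‖ < ε / 2 := by
      rw [h, sub_self, norm_zero]; exact half_pos hε
    have := cutLim_le_of_norm_sub_lt τ hx hy (half_pos hε).le h0
    rw [add_halves] at this
    exact this.trans (cutLim_le_genLimSeq τ (half_pos hε) y)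
  exact le_antisymm (key x y hx hy h) (key y x hy hx h.symm)

theorem genLim_ultraMk (τ : ℕ → LSCTrace B) {x : BddSeq B} (hx : ∀ n, 0 ≤ x n) :
    genLim ω τ (ultraMk ω B x) = genLimSeq ω τ x := by
  refine le_antisymm (iInf_le_of_le x (iInf_le_of_le hx (iInf_le _ rfl))) ?_
  refine le_iInf fun y => le_iInf fun hy => le_iInf fun hxy => ?_
  exact (genLimSeq_congr τ hx hy hxy.symm).le

/-- The infimum runs over an empty set. The value agrees with the convention for `LSCTrace.val`. -/
theorem genLim_eq_top (τ : ℕ → LSCTrace B) {q : Ultrapower ω B} (hq : ¬ 0 ≤ q) :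
    genLim ω τ q = ∞ := by
  refine iInf_eq_top.mpr fun x => iInf_eq_top.mpr fun hx => iInf_eq_top.mpr fun h => ?_
  exact absurd (h ▸ ultraMk_nonneg hx) hq

theorem genLimSeq_add (τ : ℕ → LSCTrace B) {x y : BddSeq B} (hx : ∀ n, 0 ≤ x n)
    (hy : ∀ n, 0 ≤ y n) : genLimSeq ω τ (x + y) = genLimSeq ω τ x + genLimSeq ω τ y := by
  apply le_antisymm
  · rw [genLimSeq_eq]
    refine iSup₂_le fun ε hε => ?_
    have hε3 : 0 < ε / 3 := by positivity
    refine le_trans ?_ (add_le_add (cutLim_le_genLimSeq τ hε3 x) (cutLim_le_genLimSeq τ hε3 y))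
    refine le_of_tendsto_of_tendsto' (tendsto_cutLim τ ε (x + y))
      ((tendsto_cutLim τ (ε / 3) x).add (tendsto_cutLim τ (ε / 3) y)) fun n => ?_
    have := (τ n).val_cutDown_add_le_add (hx n) (hy n) hε3
    rwa [mul_div_cancel₀ ε (three_ne_zero)] at this
  · rw [genLimSeq_eq τ x, genLimSeq_eq τ y]
    refine ENNReal.biSup_add_biSup_le' ⟨1, one_pos⟩ ⟨1, one_pos⟩ fun ε hε δ hδ => ?_
    -- The two suprema run over independent parameters; both are dominated by the cut-down at their
    -- minimum, and halving it leaves the strict gap that superadditivity needs.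
    have hm : 0 < min ε δ := lt_min hε hδ
    refine le_trans ?_ (cutLim_le_genLimSeq τ (half_pos hm) (x + y))
    refine le_of_tendsto_of_tendsto' ((tendsto_cutLim τ ε x).add (tendsto_cutLim τ δ y))
      (tendsto_cutLim τ (min ε δ / 2) (x + y)) fun n => ?_
    refine le_trans (add_le_add ?_ ?_)
      ((τ n).val_cutDown_add_val_cutDown_le (hx n) (hy n) (half_pos hm) (half_lt_self hm))
    · exact (τ n).val_mono (cutDown_nonneg _ _) (cutDown_antitone _ hm.le (min_le_left _ _))
    · exact (τ n).val_mono (cutDown_nonneg _ _) (cutDown_antitone _ hm.le (min_le_right _ _))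

theorem le_genLimSeq_smul (τ : ℕ → LSCTrace B) {x : BddSeq B} (hx : ∀ n, 0 ≤ x n) {c : ℝ}
    (hc : 0 < c) : ENNReal.ofReal c * genLimSeq ω τ x ≤ genLimSeq ω τ (c • x) := by
  rw [genLimSeq_eq τ x]
  simp only [ENNReal.mul_iSup]
  refine iSup₂_le fun ε hε => ?_
  refine le_trans ?_ (cutLim_le_genLimSeq τ (mul_pos hc hε) (c • x))
  refine le_of_tendsto_of_tendsto' (ENNReal.Tendsto.const_mul (tendsto_cutLim τ ε x)
    (Or.inr ENNReal.ofReal_ne_top)) (tendsto_cutLim τ (c * ε) (c • x)) fun n => ?_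
  rw [lp.coeFn_smul, Pi.smul_apply, cutDown_smul (hx n) hc hε.le,
    (τ n).val_smul hc.le (cutDown_nonneg _ _)]

theorem genLimSeq_smul (τ : ℕ → LSCTrace B) {x : BddSeq B} (hx : ∀ n, 0 ≤ x n) {c : ℝ}
    (hc : 0 < c) : genLimSeq ω τ (c • x) = ENNReal.ofReal c * genLimSeq ω τ x := by
  refine le_antisymm ?_ (le_genLimSeq_smul τ hx hc)
  have hcx : ∀ n, 0 ≤ (c • x) n := fun n =>
    show (0 : B) ≤ c • x n from smul_nonneg hc.le (hx n)
  -- The reverse inequality is the same one for `c⁻¹` and `c • x`.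
  have := le_genLimSeq_smul (ω := ω) τ hcx (inv_pos.mpr hc)
  rw [smul_smul, inv_mul_cancel₀ hc.ne', one_smul] at this
  calc genLimSeq ω τ (c • x)
      = ENNReal.ofReal c * (ENNReal.ofReal c⁻¹ * genLimSeq ω τ (c • x)) := by
        rw [← mul_assoc, ← ENNReal.ofReal_mul hc.le, mul_inv_cancel₀ hc.ne', ENNReal.ofReal_one,
          one_mul]
    _ ≤ _ := by gcongr

theorem genLimSeq_star_mul_le (τ : ℕ → LSCTrace B) (y : BddSeq B) :
    genLimSeq ω τ (y * star y) ≤ genLimSeq ω τ (star y * y) :=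
  genLimSeq_mono fun ε hε => ⟨ε / 2, half_pos hε, Eventually.of_forall fun n =>
    (τ n).val_cutDown_mul_star_le (y n) (half_pos hε) (half_lt_self hε)⟩

theorem genLimSeq_star_mul (τ : ℕ → LSCTrace B) (y : BddSeq B) :
    genLimSeq ω τ (star y * y) = genLimSeq ω τ (y * star y) := by
  refine le_antisymm ?_ (genLimSeq_star_mul_le τ y)
  have := genLimSeq_star_mul_le (ω := ω) τ (star y)
  rwa [star_star] at this

/-- If the value at `q` exceeds `r`, then already the limit of the traces of the cut-downs at some
`ε` does. For `p` within `ε / 2` of `q`, the cut-downs of `p` at `ε / 2` dominate that limit. -/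
theorem lowerSemicontinuous_genLim (τ : ℕ → LSCTrace B) :
    LowerSemicontinuous fun q : {q : Ultrapower ω B // 0 ≤ q} => genLim ω τ (q : Ultrapower ω B) := by
  rintro ⟨q, hq⟩ r hr
  obtain ⟨v, rfl⟩ := exists_nonneg_lift hq
  have hv : ∀ n, 0 ≤ (star v * v) n := fun n => star_mul_self_nonneg (v n)
  change r < genLim ω τ _ at hr
  rw [genLim_ultraMk τ hv, genLimSeq_eq] at hr
  obtain ⟨ε, hr⟩ := lt_iSup_iff.mp hr
  obtain ⟨hε, hr⟩ := lt_iSup_iff.mp hr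
  filter_upwards [Metric.ball_mem_nhds _ (half_pos hε)] with p hp
  obtain ⟨p, hp0⟩ := p
  obtain ⟨w, rfl⟩ := exists_nonneg_lift hp0
  have hw : ∀ n, 0 ≤ (star w * w) n := fun n => star_mul_self_nonneg (w n)
  rw [genLim_ultraMk τ hw]
  rw [Metric.mem_ball, Subtype.dist_eq, dist_eq_norm, norm_sub_rev] at hp
  have := cutLim_le_of_norm_sub_lt τ hv hw (half_pos hε).le hp
  rw [add_halves] at this
  exact hr.trans_le (this.trans (cutLim_le_genLimSeq τ (half_pos hε) _))

variable (ω) in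
/-- The generalised limit trace, as a lower semicontinuous trace on the ultrapower. -/
noncomputable def genLimTrace (τ : ℕ → LSCTrace B) : LSCTrace (Ultrapower ω B) where
  toFun q := genLim ω τ (q : Ultrapower ω B)
  map_zero' := by
    have h0 : ∀ n, (0 : B) ≤ (0 : BddSeq B) n := fun _ => le_rfl
    rw [← map_zero (ultraMk ω B), genLim_ultraMk τ h0]
    refine le_antisymm ?_ zero_le
    rw [genLimSeq_eq]
    refine iSup₂_le fun ε _ => (tendsto_nhds_unique (tendsto_cutLim τ ε 0) ?_).le
    refine tendsto_const_nhds.congr fun n => ?_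
    rw [lp.coeFn_zero, Pi.zero_apply, cutDown_zero, (τ n).val_zero]
  map_add' := by
    rintro ⟨p, hp⟩ ⟨q, hq⟩
    obtain ⟨v, rfl⟩ := exists_nonneg_lift hp
    obtain ⟨w, rfl⟩ := exists_nonneg_lift hq
    have hv : ∀ n, 0 ≤ (star v * v) n := fun n => star_mul_self_nonneg (v n)
    have hw : ∀ n, 0 ≤ (star w * w) n := fun n => star_mul_self_nonneg (w n)
    have hvw : ∀ n, 0 ≤ (star v * v + star w * w) n := fun n => add_nonneg (hv n) (hw n)
    change genLim ω τ (ultraMk ω B _ + ultraMk ω B _) = _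
    rw [← map_add, genLim_ultraMk τ hvw, genLim_ultraMk τ hv, genLim_ultraMk τ hw,
      genLimSeq_add τ hv hw]
  map_smul' := by
    rintro c hc ⟨p, hp⟩
    obtain ⟨v, rfl⟩ := exists_nonneg_lift hp
    have hv : ∀ n, 0 ≤ (star v * v) n := fun n => star_mul_self_nonneg (v n)
    have hcv : ∀ n, 0 ≤ (c • (star v * v)) n := fun n =>
      show (0 : B) ≤ c • (star v * v) n from smul_nonneg hc.le (hv n)
    have e : c • ultraMk ω B (star v * v) = ultraMk ω B (c • (star v * v)) :=
      (map_smul (ultraMk ω B) (c : ℂ) (star v * v)).symm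
    change genLim ω τ (c • ultraMk ω B _) = _
    rw [e, genLim_ultraMk τ hcv, genLim_ultraMk τ hv, genLimSeq_smul τ hv hc]
  map_star_mul' := by
    intro y
    obtain ⟨v, rfl⟩ := ultraMk_surjective B y
    have hv : ∀ n, 0 ≤ (star v * v) n := fun n => star_mul_self_nonneg (v n)
    have hv' : ∀ n, 0 ≤ (v * star v) n := fun n => mul_star_self_nonneg (v n)
    change genLim ω τ (star (ultraMk ω B v) * ultraMk ω B v) =
      genLim ω τ (ultraMk ω B v * star (ultraMk ω B v))
    rw [← map_star, ← map_mul, ← map_mul, genLim_ultraMk τ hv, genLim_ultraMk τ hv',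
      genLimSeq_star_mul]
  lsc' := lowerSemicontinuous_genLim τ

theorem val_genLimTrace (τ : ℕ → LSCTrace B) (q : Ultrapower ω B) :
    (genLimTrace ω τ).val q = genLim ω τ q := by
  by_cases hq : 0 ≤ q
  · rw [LSCTrace.val_of_nonneg _ hq]; rfl
  · rw [LSCTrace.val, dif_neg hq, genLim_eq_top τ hq]

end GenLim

/-! ## Operations on traces -/

section Operations

variable {B C : Type*} [NonUnitalCStarAlgebra B] [PartialOrder B] [StarOrderedRing B]
  [NonUnitalCStarAlgebra C] [PartialOrder C] [StarOrderedRing C]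

/-- The square root of `y` commutes with `p` and `p*`, so it can be distributed over the two
factors. The product then has the form to which the trace property applies. -/
theorem star_mul_self_mul_eq {y p : C} (hy : 0 ≤ y) (h : Commute y p) :
    star p * p * y = star (p * CFC.sqrt y) * (p * CFC.sqrt y) := by
  have hs : Commute (CFC.sqrt y) p := by
    rw [CFC.sqrt_eq_real_sqrt y hy]; exact h.cfcₙ_real _
  have hss := (IsSelfAdjoint.of_nonneg (CFC.sqrt_nonneg y)).star_eq
  have hs' : Commute (CFC.sqrt y) (star p) := by
    have := hs.star_star; rwa [hss] at this
  conv_lhs => rw [← CFC.sqrt_mul_sqrt_self y hy]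
  rw [star_mul, hss, mul_assoc (CFC.sqrt y), ← mul_assoc (star p), ← mul_assoc (CFC.sqrt y),
    (hs'.mul_right hs).eq]
  simp only [mul_assoc]

namespace LSCTrace

theorem val_star_mul_mul (ρ : LSCTrace C) {y p : C} (hy : 0 ≤ y) (h : Commute y p) :
    ρ.val (star p * p * y) = ρ.val (p * star p * y) := by
  have h' : Commute y (star p) := by
    have := h.star_star; rwa [(IsSelfAdjoint.of_nonneg hy).star_eq] at this
  have hs : Commute (CFC.sqrt y) p := by
    rw [CFC.sqrt_eq_real_sqrt y hy]; exact h.cfcₙ_real _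
  have hs' : Commute (CFC.sqrt y) (star p) := by
    rw [CFC.sqrt_eq_real_sqrt y hy]; exact h'.cfcₙ_real _
  have hss := (IsSelfAdjoint.of_nonneg (CFC.sqrt_nonneg y)).star_eq
  have e := star_mul_self_mul_eq hy h'
  rw [star_star] at e
  rw [star_mul_self_mul_eq hy h, val_star_mul, e, star_mul, star_mul, star_star, hss]
  congr 1
  rw [← hs'.eq, ← mul_assoc, hs.eq, mul_assoc, mul_assoc]

/-- The pullback of a trace along a ⋆-homomorphism. -/
noncomputable def comap (ρ : LSCTrace C) (f : B →⋆ₙₐ[ℂ] C) : LSCTrace B where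
  toFun b := ρ.val (f b)
  map_zero' := by rw [map_zero, val_zero]
  map_add' x y := by
    rw [map_add, ρ.val_add (map_nonneg f x.2) (map_nonneg f y.2)]
  map_smul' c hc x := by
    have : f (c • (x : B)) = c • f x := map_smul f (c : ℂ) (x : B)
    rw [this, ρ.val_smul hc.le (map_nonneg f x.2)]
  map_star_mul' y := by rw [map_mul, map_mul, map_star, val_star_mul]
  lsc' := by
    have : (fun b : {b : B // 0 ≤ b} => ρ.val (f b)) =
        ρ.toFun ∘ fun b : {b : B // 0 ≤ b} => ⟨f b, map_nonneg f b.2⟩ :=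
      funext fun b => ρ.val_of_nonneg _
    rw [this]
    exact ρ.lsc'.comp (((map_continuous f).comp continuous_subtype_val).subtype_mk _)

theorem val_comap (ρ : LSCTrace C) (f : B →⋆ₙₐ[ℂ] C) {b : B} (hb : 0 ≤ b) :
    (ρ.comap f).val b = ρ.val (f b) := val_of_nonneg _ hb

/-- The trace `b ↦ ρ(f(b) y)` for a positive `y` that commutes with the range of `f`. -/
noncomputable def twist (ρ : LSCTrace C) (f : B →⋆ₙₐ[ℂ] C) {y : C} (hy : 0 ≤ y)
    (h : ∀ b, Commute y (f b)) : LSCTrace B where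
  toFun b := ρ.val (f b * y)
  map_zero' := by rw [map_zero, zero_mul, val_zero]
  map_add' b c := by
    rw [map_add, add_mul, ρ.val_add ((h b).symm.mul_nonneg (map_nonneg f b.2) hy)
      ((h c).symm.mul_nonneg (map_nonneg f c.2) hy)]
  map_smul' c hc x := by
    have : f (c • (x : B)) = c • f x := map_smul f (c : ℂ) (x : B)
    rw [this, smul_mul_assoc, ρ.val_smul hc.le ((h x).symm.mul_nonneg (map_nonneg f x.2) hy)]
  map_star_mul' b := by
    rw [map_mul, map_mul, map_star, ρ.val_star_mul_mul hy (h b)]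
  lsc' := by
    have : (fun b : {b : B // 0 ≤ b} => ρ.val (f b * y)) = ρ.toFun ∘ fun b : {b : B // 0 ≤ b} =>
        ⟨f b * y, (h b).symm.mul_nonneg (map_nonneg f b.2) hy⟩ :=
      funext fun b => ρ.val_of_nonneg _
    rw [this]
    exact ρ.lsc'.comp ((((map_continuous f).comp continuous_subtype_val).mul
      continuous_const).subtype_mk _)

theorem val_twist (ρ : LSCTrace C) (f : B →⋆ₙₐ[ℂ] C) {y : C} (hy : 0 ≤ y)
    (h : ∀ b, Commute y (f b)) {b : B} (hb : 0 ≤ b) : (ρ.twist f hy h).val b = ρ.val (f b * y) :=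
  val_of_nonneg _ hb

/-- By commutation `y x = y^{1/2} x y^{1/2} ≤ ‖x‖ y`. This bounds the functionals `ρ_b`. -/
theorem val_mul_le_norm (ρ : LSCTrace C) {x y : C} (hx : 0 ≤ x) (hy : 0 ≤ y) (h : Commute y x) :
    ρ.val (y * x) ≤ ENNReal.ofReal ‖x‖ * ρ.val y := by
  have hs : Commute (CFC.sqrt y) x := by
    rw [CFC.sqrt_eq_real_sqrt y hy]; exact h.cfcₙ_real _
  have hss := (IsSelfAdjoint.of_nonneg (CFC.sqrt_nonneg y)).star_eq
  have hyy := CFC.sqrt_mul_sqrt_self y hy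
  have e : y * x = star (CFC.sqrt y) * x * CFC.sqrt y := by
    rw [hss, hs.eq, mul_assoc, hyy, h.eq]
  rw [← ρ.val_smul (norm_nonneg x) hy]
  refine ρ.val_mono (h.mul_nonneg hy hx) ?_
  rw [e]
  refine (CStarAlgebra.star_left_conjugate_le_norm_smul (IsSelfAdjoint.of_nonneg hx)).trans ?_
  rw [hss, hyy]

end LSCTrace

end Operations

/-! ## Traces on the stabilisation -/

section StabTrace

variable {A : Type*} [NonUnitalCStarAlgebra A] [PartialOrder A] [StarOrderedRing A]

/-- The matrix `x ⊗ e_ij` in `M_N(A)`. -/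
def MatAlg.single (N i j : ℕ) (x : A) : MatAlg A N :=
  MatAlg.of fun k l => if (k : ℕ) = i ∧ (l : ℕ) = j then x else 0

theorem MatAlg.entry_single (N i j : ℕ) (x : A) (k l : Fin N) :
    (MatAlg.single N i j x).entry k l = if (k : ℕ) = i ∧ (l : ℕ) = j then x else 0 := rfl

theorem MatAlg.single_mul_single {N : ℕ} (i l : ℕ) {j : ℕ} (hj : j < N) (x y : A) :
    MatAlg.single N i j x * MatAlg.single N j l y = MatAlg.single N i l (x * y) := by
  refine MatAlg.ext fun k m => ?_
  rw [MatAlg.entry_mul]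
  simp only [MatAlg.entry_single]
  rw [Finset.sum_eq_single ⟨j, hj⟩]
  · by_cases hk : (k : ℕ) = i <;> by_cases hm : (m : ℕ) = l <;> simp [hk, hm]
  · intro n _ hn
    have : (n : ℕ) ≠ j := fun h => hn (Fin.ext h)
    simp [this]
  · simp

theorem MatAlg.star_single (N i j : ℕ) (x : A) :
    star (MatAlg.single N i j x) = MatAlg.single N j i (star x) := by
  refine MatAlg.ext fun k m => ?_
  rw [MatAlg.entry_star]
  simp only [MatAlg.entry_single]
  by_cases hk : (k : ℕ) = j <;> by_cases hm : (m : ℕ) = i <;> simp [hk, hm]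

theorem MatAlg.single_mul_mul_single {N i : ℕ} (hi : i < N) (v : A) (y : MatAlg A N) :
    MatAlg.single N i i v * y * MatAlg.single N i i v =
      MatAlg.single N i i (v * y.entry ⟨i, hi⟩ ⟨i, hi⟩ * v) := by
  refine MatAlg.ext fun k m => ?_
  rw [MatAlg.entry_mul, Finset.sum_eq_single ⟨i, hi⟩]
  · rw [MatAlg.entry_mul, Finset.sum_eq_single ⟨i, hi⟩]
    · simp only [MatAlg.entry_single]
      by_cases hk : (k : ℕ) = i <;> by_cases hm : (m : ℕ) = i <;> simp [hk, hm]
    · intro n _ hn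
      have : (n : ℕ) ≠ i := fun h => hn (Fin.ext h)
      simp [MatAlg.entry_single, this]
    · simp
  · intro n _ hn
    have : (n : ℕ) ≠ i := fun h => hn (Fin.ext h)
    simp [MatAlg.entry_single, this]
  · simp

theorem MatAlg.entry_sum {ι : Type*} {N : ℕ} (s : Finset ι) (f : ι → MatAlg A N) (k l : Fin N) :
    (∑ i ∈ s, f i).entry k l = ∑ i ∈ s, (f i).entry k l :=
  map_sum ({ toFun := fun x => x.entry k l, map_zero' := rfl, map_add' := fun _ _ => rfl } :
    MatAlg A N →+ A) f s

theorem diagHom_eq_sum (N : ℕ) (u : A) :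
    diagHom N u = ∑ i ∈ Finset.range N, MatAlg.single N i i u := by
  refine MatAlg.ext fun k l => ?_
  rw [MatAlg.entry_sum, diagHom_entry, Finset.sum_eq_single (k : ℕ)]
  · rw [MatAlg.entry_single]
    simp [Fin.ext_iff, eq_comm]
  · intro n _ hn
    simp [MatAlg.entry_single, hn.symm]
  · intro h
    exact absurd (Finset.mem_range.mpr k.2) h

/-- The element `x ⊗ e_ij` of `A ⊗ 𝕂`. -/
noncomputable def Stab.single (i j : ℕ) (x : A) : Stab A :=
  corner (max i j + 1) (MatAlg.single (max i j + 1) i j x)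

theorem padHom_single {N M : ℕ} (h : N ≤ M) {i j : ℕ} (hi : i < N) (hj : j < N) (x : A) :
    padHom h (MatAlg.single N i j x) = MatAlg.single M i j x := by
  refine MatAlg.ext fun k l => ?_
  by_cases hkl : (k : ℕ) < N ∧ (l : ℕ) < N
  · rw [padHom_pos h _ hkl]; rfl
  · rw [padHom_neg h _ hkl, MatAlg.entry_single, if_neg]
    rintro ⟨rfl, rfl⟩
    exact hkl ⟨hi, hj⟩

theorem corner_single {N i j : ℕ} (hi : i < N) (hj : j < N) (x : A) :
    corner N (MatAlg.single N i j x) = Stab.single i j x := by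
  have h : max i j + 1 ≤ N := by omega
  rw [Stab.single, ← corner_padHom h, padHom_single h (by omega) (by omega)]

namespace Stab

theorem single_mul_single (i j l : ℕ) (x y : A) :
    single i j x * single j l y = single i l (x * y) := by
  have hi : i < i + j + l + 1 := by omega
  have hj : j < i + j + l + 1 := by omega
  have hl : l < i + j + l + 1 := by omega
  rw [← corner_single hi hj, ← corner_single hj hl, ← corner_single hi hl, ← map_mul,
    MatAlg.single_mul_single i l hj]

theorem star_single (i j : ℕ) (x : A) : star (single i j x) = single j i (star x) := by
  have hi : i < i + j + 1 := by omega
  have hj : j < i + j + 1 := by omega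
  rw [← corner_single hi hj, ← corner_single hj hi, ← map_star, MatAlg.star_single]

theorem norm_entryLim_le (i j : ℕ) (x : stableClosure A) : ‖entryLim i j x‖ ≤ ‖x‖ :=
  le_of_tendsto (tendsto_entryLim i j x).norm (Eventually.of_forall fun n =>
    (norm_entrySeq_le i j _ n).trans (lp.norm_apply_le_norm ENNReal.top_ne_zero (x : MatSeq A) n))

theorem continuous_entry (i j : ℕ) : Continuous (entry i j : Stab A → A) := by
  refine AddMonoidHomClass.continuous_of_bound (entry i j : Stab A →ₗ[ℂ] A) 1 fun q => ?_
  refine le_of_forall_pos_le_add fun ε hε => ?_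
  obtain ⟨x, rfl, hx⟩ := CStarIdeal.exists_norm_lt _ q hε
  rw [one_mul]
  exact (norm_entryLim_le i j x).trans hx.le

theorem continuous_single (i j : ℕ) : Continuous (single i j : A → Stab A) := by
  refine (map_continuous (corner (max i j + 1))).comp ?_
  have : Continuous fun x : A => (fun k l => if (k : ℕ) = i ∧ (l : ℕ) = j then x else 0 :
      Fin (max i j + 1) → Fin (max i j + 1) → A) := by
    refine continuous_pi fun k => continuous_pi fun l => ?_
    split_ifs
    · exact continuous_id
    · exact continuous_const
  exact this

/-- Both sides are continuous in `b`, so the identity reduces to finite matrices. -/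
theorem single_mul_mul_single (i : ℕ) (v : A) (b : Stab A) :
    single i i v * b * single i i v = single i i (v * entry i i b * v) := by
  induction b using Stab.induction with
  | hp =>
    have := continuous_entry (A := A) i i
    have := continuous_single (A := A) i i
    exact isClosed_eq (by fun_prop) (by fun_prop)
  | h N y =>
    have hN : N ≤ N + i + 1 := by omega
    have hi : i < N + i + 1 := by omega
    rw [← corner_padHom hN y, ← corner_single hi hi, ← map_mul, ← map_mul,
      MatAlg.single_mul_mul_single hi, corner_single hi hi,
      ← entry_corner (padHom hN y) ⟨i, hi⟩ ⟨i, hi⟩]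

theorem single_mul_star_self (i : ℕ) (y : A) :
    single i 0 y * star (single i 0 y) = single i i (y * star y) := by
  rw [star_single, single_mul_single]

theorem star_single_mul_self (i : ℕ) (y : A) :
    star (single i 0 y) * single i 0 y = single 0 0 (star y * y) := by
  rw [star_single, single_mul_single]

theorem single_nonneg (i : ℕ) {x : A} (hx : 0 ≤ x) : 0 ≤ single i i x := by
  obtain ⟨y, rfl⟩ := CStarAlgebra.nonneg_iff_eq_star_mul_self.mp hx
  have := mul_star_self_nonneg (single i 0 (star y))
  rwa [single_mul_star_self, star_star] at this

end Stab

theorem ampl_eq_sum (N : ℕ) (u : A) : ampl N u = ∑ i ∈ Finset.range N, Stab.single i i u := by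
  rw [ampl, NonUnitalStarAlgHom.comp_apply, diagHom_eq_sum, map_sum]
  exact Finset.sum_congr rfl fun i hi =>
    corner_single (Finset.mem_range.mp hi) (Finset.mem_range.mp hi) u

theorem ampl_one (x : A) : ampl 1 x = Stab.single 0 0 x := by
  rw [ampl_eq_sum, Finset.sum_range_one]

theorem Stab.entry_ampl_one (i : ℕ) (x : A) :
    Stab.entry i i (ampl 1 x) = if i = 0 then x else 0 := by
  have h : 1 ≤ i + 1 := by omega
  have hi : i < i + 1 := by omega
  rw [ampl_one, ← corner_single (N := i + 1) (by omega) (by omega)]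
  refine (Stab.entry_corner _ ⟨i, hi⟩ ⟨i, hi⟩).trans ?_
  simp [MatAlg.entry_single]

/-- The elements `u ⊗ 1_N` form an approximate unit of `A ⊗ 𝕂`. -/
theorem exists_norm_ampl_mul_sub_lt (c : Stab A) {ε : ℝ} (hε : 0 < ε) :
    ∃ (N : ℕ) (u : A), 0 ≤ u ∧ ‖u‖ ≤ 1 ∧ ‖ampl N u * c - c‖ < ε := by
  -- The quantifier over `ε` belongs to the property of `c`: only then is the property closed, so
  -- that it can be checked on corners.
  have key : ∀ c : Stab A, ∀ ε : ℝ, 0 < ε →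
      ∃ (N : ℕ) (u : A), 0 ≤ u ∧ ‖u‖ ≤ 1 ∧ ‖ampl N u * c - c‖ < ε := by
    intro c
    induction c using Stab.induction with
    | hp =>
      refine isClosed_of_closure_subset fun c hc ε hε => ?_
      obtain ⟨d, hd, hcd⟩ := Metric.mem_closure_iff.mp hc (ε / 3) (by positivity)
      obtain ⟨N, u, hu, hu1, hN⟩ := hd (ε / 3) (by positivity)
      refine ⟨N, u, hu, hu1, ?_⟩
      rw [dist_eq_norm] at hcd
      have e : ampl N u * c - c = ampl N u * (c - d) + (ampl N u * d - d) - (c - d) := by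
        noncomm_ring
      have h1 : ‖ampl N u * (c - d)‖ ≤ ‖c - d‖ := by
        refine (norm_mul_le _ _).trans ?_
        refine mul_le_of_le_one_left (norm_nonneg _) ?_
        exact (NonUnitalStarAlgHom.norm_apply_le (ampl N) u).trans hu1
      rw [e]
      refine (norm_sub_le _ _).trans_lt ?_
      have := norm_add_le (ampl N u * (c - d)) (ampl N u * d - d)
      linarith
    | h N y =>
      intro ε hε
      have hU := CStarAlgebra.increasingApproximateUnit A
      have := hU.neBot
      have ht : Tendsto (fun u : A => ‖(MatAlg.of fun i j => u * y.entry i j : MatAlg A N) - y‖)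
          (CStarAlgebra.approximateUnit A) (𝓝 0) := by
        refine MatAlg.tendsto_norm fun i j => ?_
        rw [← tendsto_zero_iff_norm_tendsto_zero]
        have := (hU.tendsto_mul_right (y.entry i j)).sub_const (y.entry i j)
        rwa [sub_self] at this
      obtain ⟨u, h1, h0, hu⟩ := (((Metric.tendsto_nhds.mp ht) ε hε).and
        (hU.eventually_nonneg.and hU.eventually_norm)).exists
      refine ⟨N, u, h0, hu, ?_⟩
      rw [dist_zero_right, norm_norm] at h1
      rw [ampl_mul_corner le_rfl, ← map_sub]
      exact (NonUnitalStarAlgHom.norm_apply_le (corner N) _).trans_lt h1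
  exact key c ε hε

theorem conjugate_le_self {c u : A} (hc : IsSelfAdjoint c) (hu : 0 ≤ u) (hu1 : ‖u‖ ≤ 1) :
    c * u * c ≤ c * c := by
  have := CStarAlgebra.star_left_conjugate_le_norm_smul (a := c) (IsSelfAdjoint.of_nonneg hu)
  rw [hc.star_eq] at this
  refine this.trans ?_
  have hcc : 0 ≤ c * c := by have := star_mul_self_nonneg c; rwa [hc.star_eq] at this
  calc ‖u‖ • (c * c) ≤ (1 : ℝ) • (c * c) := smul_le_smul_of_nonneg_right hu1 hcc
    _ = _ := one_smul _ _

/-! ### The diagonal formula for a trace on the stabilisation. -/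

namespace LSCTrace

variable (ρ : LSCTrace (Stab A))

/-- The element `x^{1/2} ⊗ e_i0` implements an equivalence between `x ⊗ e_00` and `x ⊗ e_ii`, so the
trace takes the same value on all diagonal positions. -/
theorem val_single (i : ℕ) {x : A} (hx : 0 ≤ x) :
    ρ.val (Stab.single i i x) = (ρ.comap (ampl 1)).val x := by
  have hs := (IsSelfAdjoint.of_nonneg (CFC.sqrt_nonneg x)).star_eq
  have hxx := CFC.sqrt_mul_sqrt_self x hx
  have := ρ.val_star_mul (Stab.single i 0 (CFC.sqrt x))
  rw [Stab.star_single_mul_self, Stab.single_mul_star_self, hs, hxx] at this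
  rw [val_comap _ _ hx, ampl_one, this]

/-- The trace property is used twice. In `A ⊗ 𝕂` it turns `b^{1/2} (u ⊗ e_ii) b^{1/2}` into `u^{1/2}
b_ii u^{1/2} ⊗ e_ii`, which only sees the diagonal entry; in `A` it turns `u^{1/2} b_ii u^{1/2}`
into `b_ii^{1/2} u b_ii^{1/2}`, which is comparable with `b_ii`. -/
theorem val_conjugate_ampl {b : Stab A} (hb : 0 ≤ b) (N : ℕ) {u : A} (hu : 0 ≤ u) :
    ρ.val (CFC.sqrt b * ampl N u * CFC.sqrt b) = ∑ i ∈ Finset.range N, (ρ.comap (ampl 1)).val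
      (CFC.sqrt (Stab.entry i i b) * u * CFC.sqrt (Stab.entry i i b)) := by
  have hcs := IsSelfAdjoint.of_nonneg (CFC.sqrt_nonneg b)
  have hcc := CFC.sqrt_mul_sqrt_self b hb
  set c := CFC.sqrt b
  have hconj : ∀ i, 0 ≤ c * Stab.single i i u * c := fun i => by
    have := star_left_conjugate_nonneg (Stab.single_nonneg i hu) c
    rwa [hcs.star_eq] at this
  rw [ampl_eq_sum, Finset.mul_sum, Finset.sum_mul, ρ.val_sum _ _ fun i _ => hconj i]
  refine Finset.sum_congr rfl fun i _ => ?_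
  have hvs := (IsSelfAdjoint.of_nonneg (CFC.sqrt_nonneg u)).star_eq
  have hvv := CFC.sqrt_mul_sqrt_self u hu
  set v := CFC.sqrt u
  have hd := Stab.entry_nonneg i hb
  have hws := (IsSelfAdjoint.of_nonneg (CFC.sqrt_nonneg (Stab.entry i i b))).star_eq
  have hww := CFC.sqrt_mul_sqrt_self _ hd
  set w := CFC.sqrt (Stab.entry i i b)
  have e1 : c * Stab.single i i u * c = star (Stab.single i i v * c) * (Stab.single i i v * c) := by
    rw [star_mul, hcs.star_eq, Stab.star_single, hvs, ← hvv, ← Stab.single_mul_single i i i]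
    noncomm_ring
  have e2 : (Stab.single i i v * c) * star (Stab.single i i v * c) =
      Stab.single i i ((v * w) * star (v * w)) := by
    have h1 : (v * w) * star (v * w) = v * Stab.entry i i b * v := by
      rw [star_mul, hws, hvs, ← hww]; noncomm_ring
    rw [h1, ← Stab.single_mul_mul_single, star_mul, hcs.star_eq, Stab.star_single, hvs, ← hcc]
    noncomm_ring
  have e3 : star (v * w) * (v * w) = w * u * w := by
    rw [star_mul, hws, hvs, ← hvv]; noncomm_ring
  rw [e1, val_star_mul, e2, val_single _ _ (mul_star_self_nonneg _), ← val_star_mul, e3]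

/-- Every lower semicontinuous trace on `A ⊗ 𝕂` is of the form `τ ⊗ Tr`. -/
theorem val_eq_tsum {b : Stab A} (hb : 0 ≤ b) :
    ρ.val b = ∑' i : ℕ, (ρ.comap (ampl 1)).val (Stab.entry i i b) := by
  have hcs := IsSelfAdjoint.of_nonneg (CFC.sqrt_nonneg b)
  have hcc := CFC.sqrt_mul_sqrt_self b hb
  have hsub : ∀ i, IsSelfAdjoint (CFC.sqrt (Stab.entry i i b)) := fun i =>
    IsSelfAdjoint.of_nonneg (CFC.sqrt_nonneg _)
  have hsq : ∀ i, CFC.sqrt (Stab.entry i i b) * CFC.sqrt (Stab.entry i i b) = Stab.entry i i b :=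
    fun i => CFC.sqrt_mul_sqrt_self _ (Stab.entry_nonneg i hb)
  have hconj : ∀ (i : ℕ) (u : A), 0 ≤ u →
      0 ≤ CFC.sqrt (Stab.entry i i b) * u * CFC.sqrt (Stab.entry i i b) := fun i u hu => by
    have := star_left_conjugate_nonneg hu (CFC.sqrt (Stab.entry i i b))
    rwa [(hsub i).star_eq] at this
  have hconj' : ∀ (N : ℕ) (u : A), 0 ≤ u → 0 ≤ CFC.sqrt b * ampl N u * CFC.sqrt b :=
    fun N u hu => by
      have := star_left_conjugate_nonneg (map_nonneg (ampl N) hu) (CFC.sqrt b)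
      rwa [hcs.star_eq] at this
  apply le_antisymm
  -- Upper bound: a sequence `b^{1/2} (u ⊗ 1_N) b^{1/2}` converges to `b`, and each term has trace
  -- at most a partial sum of the series. Lower semicontinuity passes this to `b`.
  · have hseq : ∀ k : ℕ, ∃ (N : ℕ) (u : A), 0 ≤ u ∧ ‖u‖ ≤ 1 ∧
        ‖ampl N u * CFC.sqrt b - CFC.sqrt b‖ < 1 / ((k : ℝ) + 1) := fun k =>
      exists_norm_ampl_mul_sub_lt _ Nat.one_div_pos_of_nat
    choose N u hu hu1 hk using hseq
    have ht : Tendsto (fun k => ampl (N k) (u k) * CFC.sqrt b) atTop (𝓝 (CFC.sqrt b)) := by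
      rw [tendsto_iff_norm_sub_tendsto_zero]
      exact squeeze_zero (fun _ => norm_nonneg _) (fun k => (hk k).le)
        tendsto_one_div_add_atTop_nhds_zero_nat
    have ht' := ht.const_mul (CFC.sqrt b)
    rw [hcc] at ht'
    refine ρ.val_le_of_tendsto (Eventually.of_forall fun k => ?_) ht'
    rw [← mul_assoc]
    refine ⟨hconj' _ _ (hu k), ?_⟩
    rw [ρ.val_conjugate_ampl hb _ (hu k)]
    refine le_trans ?_ (ENNReal.sum_le_tsum (Finset.range (N k)))
    refine Finset.sum_le_sum fun i _ => val_mono _ (hconj i _ (hu k)) ?_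
    refine (conjugate_le_self (hsub i) (hu k) (hu1 k)).trans_eq (hsq i)
  -- Lower bound, for fixed `N`: along the approximate unit of `A` the tuples `b_ii^{1/2} u
  -- b_ii^{1/2}` converge to `b_ii`, and their traces add up to the trace of `b^{1/2} (u ⊗ 1_N)
  -- b^{1/2} ≤ b`. The finite sum `F` is lower semicontinuous on tuples of positive elements.
  · rw [ENNReal.tsum_eq_iSup_nat]
    refine iSup_le fun N => ?_
    have hU := CStarAlgebra.increasingApproximateUnit A
    have := hU.neBot
    let F : {p : ℕ → A // ∀ i, 0 ≤ p i} → ℝ≥0∞ := fun p =>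
      ∑ i ∈ Finset.range N, (ρ.comap (ampl 1)).toFun ⟨(p : ℕ → A) i, p.2 i⟩
    have hF : LowerSemicontinuous F := lowerSemicontinuous_sum fun i _ =>
      (ρ.comap (ampl 1)).lsc'.comp
        (((continuous_apply i).comp continuous_subtype_val).subtype_mk _)
    have hval : ∀ (p : ℕ → A) (hp : ∀ i, 0 ≤ p i),
        F ⟨p, hp⟩ = ∑ i ∈ Finset.range N, (ρ.comap (ampl 1)).val (p i) := fun p hp =>
      Finset.sum_congr rfl fun i _ => (val_of_nonneg _ (hp i)).symm
    rw [← hval _ fun i => Stab.entry_nonneg i hb]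
    -- Using `|u|` in place of `u` makes the entries positive for every `u`; along the approximate
    -- unit the two agree eventually.
    let P : A → {p : ℕ → A // ∀ i, 0 ≤ p i} := fun u =>
      ⟨fun i => CFC.sqrt (Stab.entry i i b) * CFC.abs u * CFC.sqrt (Stab.entry i i b),
        fun i => hconj i _ (CFC.abs_nonneg u)⟩
    have hP : Tendsto P (CStarAlgebra.approximateUnit A)
        (𝓝 ⟨fun i => Stab.entry i i b, fun i => Stab.entry_nonneg i hb⟩) := by
      refine tendsto_subtype_rng.mpr (tendsto_pi_nhds.mpr fun i => ?_)
      have h := (hU.tendsto_mul_right (CFC.sqrt (Stab.entry i i b))).const_mul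
        (CFC.sqrt (Stab.entry i i b))
      rw [hsq] at h
      refine h.congr' ?_
      filter_upwards [hU.eventually_nonneg] with u hu
      change _ = CFC.sqrt (Stab.entry i i b) * CFC.abs u * CFC.sqrt (Stab.entry i i b)
      rw [CFC.abs_of_nonneg u hu, mul_assoc]
    refine (hF.isClosed_preimage (ρ.val b)).mem_of_tendsto hP ?_
    filter_upwards [hU.eventually_nonneg, hU.eventually_norm] with u hu hu1
    change F (P u) ≤ _
    rw [hval]
    simp only [CFC.abs_of_nonneg u hu]
    rw [← ρ.val_conjugate_ampl hb _ hu]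
    refine ρ.val_mono (hconj' N u hu) ?_
    have := conjugate_le_self hcs (map_nonneg (ampl N) hu)
      ((NonUnitalStarAlgHom.norm_apply_le (ampl N) u).trans hu1)
    rwa [hcc] at this

end LSCTrace

/-- Evaluating on `x ⊗ e_00` forces `τ`; the converse is the diagonal formula. Existence and
uniqueness of `τ` come out together. -/
theorem isTensorTr_iff {σ : LSCTrace (Stab A)} {τ : LSCTrace A} :
    IsTensorTr σ τ ↔ τ = σ.comap (ampl 1) := by
  constructor
  · intro h
    refine LSCTrace.ext_val fun x hx => ?_
    have h1 := h ⟨ampl 1 x, map_nonneg (ampl 1) hx⟩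
    simp only [← LSCTrace.val_of_nonneg, Stab.entry_ampl_one] at h1
    rw [tsum_eq_single 0 fun i hi => by rw [if_neg hi, τ.val_zero], if_pos rfl] at h1
    rw [LSCTrace.val_comap _ _ hx, h1]
  · rintro rfl ⟨b, hb⟩
    rw [← σ.val_of_nonneg hb, σ.val_eq_tsum hb]
    exact tsum_congr fun i => LSCTrace.val_of_nonneg _ (Stab.entry_nonneg i hb)

end StabTrace

/-! ## Positive functionals -/

section Functionals

variable {F : Type*} [NonUnitalCStarAlgebra F] [PartialOrder F] [StarOrderedRing F]

theorem ContinuousLinearMap.ext_nonneg {φ ψ : F →L[ℂ] ℂ} (h : ∀ y, 0 ≤ y → φ y = ψ y) : φ = ψ := by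
  ext y
  obtain ⟨x, hx, -, rfl⟩ := CStarAlgebra.exists_sum_four_nonneg y
  simp only [map_sum, map_smul, h _ (hx _)]

/-- The factor 4 counts the positive elements, each of norm at most `‖y‖`, into which `y`
decomposes. -/
theorem ContinuousLinearMap.norm_le_of_nonneg {φ : F →L[ℂ] ℂ} {K : ℝ} (hK : 0 ≤ K)
    (h : ∀ y, 0 ≤ y → ‖φ y‖ ≤ K * ‖y‖) : ‖φ‖ ≤ 4 * K := by
  refine φ.opNorm_le_bound (by positivity) fun y => ?_
  obtain ⟨x, hx, hxn, hy⟩ := CStarAlgebra.exists_sum_four_nonneg y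
  have : ∀ i : Fin 4, ‖φ (Complex.I ^ (i : ℕ) • x i)‖ ≤ K * ‖y‖ := fun i => by
    rw [map_smul, norm_smul, norm_pow, Complex.norm_I, one_pow, one_mul]
    exact (h _ (hx i)).trans (mul_le_mul_of_nonneg_left (hxn i) hK)
  calc ‖φ y‖ = ‖∑ i : Fin 4, φ (Complex.I ^ (i : ℕ) • x i)‖ := by
        conv_lhs => rw [hy]
        rw [map_sum]
    _ ≤ ∑ i : Fin 4, ‖φ (Complex.I ^ (i : ℕ) • x i)‖ := norm_sum_le _ _
    _ ≤ ∑ _i : Fin 4, K * ‖y‖ := Finset.sum_le_sum fun i _ => this i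
    _ = 4 * K * ‖y‖ := by simp; ring

/-- A bounded additive functional on the positive cone extends to a bounded linear functional. -/
theorem exists_clm_of_additive (g : F → ℝ) {K : ℝ}
    (hadd : ∀ x y, 0 ≤ x → 0 ≤ y → g (x + y) = g x + g y)
    (hsmul : ∀ (c : ℝ) (x : F), 0 ≤ c → 0 ≤ x → g (c • x) = c * g x)
    (hnn : ∀ x, 0 ≤ x → 0 ≤ g x) (hb : ∀ x, 0 ≤ x → g x ≤ K * ‖x‖) :
    ∃ φ : F →L[ℂ] ℂ, ∀ x, 0 ≤ x → φ x = g x := by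
  -- By additivity of `g`, the value of `G` at a self-adjoint element can be computed from any
  -- difference of positive elements. This makes `G ∘ Re` real linear, with negative scalars
  -- exchanging the two parts.
  let G : F → ℝ := fun h => g h⁺ - g h⁻
  have hG : ∀ p q : F, 0 ≤ p → 0 ≤ q → G (p - q) = g p - g q := by
    intro p q hp hq
    have hsa : IsSelfAdjoint (p - q) := (IsSelfAdjoint.of_nonneg hp).sub (IsSelfAdjoint.of_nonneg hq)
    have h1 := CFC.posPart_sub_negPart (p - q) hsa
    have hP := CFC.posPart_nonneg (p - q)
    have hN := CFC.negPart_nonneg (p - q)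
    have h2 : (p - q)⁺ + q = p + (p - q)⁻ := by
      rw [← sub_eq_sub_iff_add_eq_add]; exact h1
    have h3 := congrArg g h2
    rw [hadd _ _ hP hq, hadd _ _ hp hN] at h3
    change g (p - q)⁺ - g (p - q)⁻ = _
    linarith
  have hdec : ∀ x : F, ((realPart x : selfAdjoint F) : F) =
      (realPart x : F)⁺ - (realPart x : F)⁻ := fun x =>
    (CFC.posPart_sub_negPart _ (realPart x).2).symm
  let R₀ : F →ₗ[ℝ] ℝ :=
    { toFun := fun x => G (realPart x : F)
      map_add' := fun x y => by
        have hx1 := CFC.posPart_nonneg (realPart x : F)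
        have hx2 := CFC.negPart_nonneg (realPart x : F)
        have hy1 := CFC.posPart_nonneg (realPart y : F)
        have hy2 := CFC.negPart_nonneg (realPart y : F)
        have : ((realPart (x + y) : selfAdjoint F) : F) =
            ((realPart x : F)⁺ + (realPart y : F)⁺) - ((realPart x : F)⁻ + (realPart y : F)⁻) := by
          rw [map_add, AddSubgroup.coe_add, add_sub_add_comm, ← hdec, ← hdec]
        rw [this, hG _ _ (add_nonneg hx1 hy1) (add_nonneg hx2 hy2), hadd _ _ hx1 hy1,
          hadd _ _ hx2 hy2]
        change _ = (g _ - g _) + (g _ - g _)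
        ring
      map_smul' := fun c x => by
        have hx1 := CFC.posPart_nonneg (realPart x : F)
        have hx2 := CFC.negPart_nonneg (realPart x : F)
        have e : ((realPart (c • x) : selfAdjoint F) : F) =
            c • (realPart x : F)⁺ - c • (realPart x : F)⁻ := by
          rw [map_smul, selfAdjoint.val_smul, ← smul_sub, ← hdec]
        change G _ = c • (g _ - g _)
        rcases le_total 0 c with hc | hc
        · rw [e, hG _ _ (smul_nonneg hc hx1) (smul_nonneg hc hx2), hsmul _ _ hc hx1,
            hsmul _ _ hc hx2, smul_eq_mul]
          ring
        · have hc' := neg_nonneg.mpr hc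
          have e' : ((realPart (c • x) : selfAdjoint F) : F) =
              (-c) • (realPart x : F)⁻ - (-c) • (realPart x : F)⁺ := by
            rw [e]; module
          rw [e', hG _ _ (smul_nonneg hc' hx2) (smul_nonneg hc' hx1), hsmul _ _ hc' hx1,
            hsmul _ _ hc' hx2, smul_eq_mul]
          ring }
  have hR₀ : ∀ x, R₀ x = G (realPart x : F) := fun _ => rfl
  let R : StrongDual ℝ F := R₀.mkContinuous (2 * |K|) fun x => by
    have hx1 := CFC.posPart_nonneg (realPart x : F)
    have hx2 := CFC.negPart_nonneg (realPart x : F)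
    have hb' : ∀ y : F, 0 ≤ y → ‖y‖ ≤ ‖x‖ → |g y| ≤ |K| * ‖x‖ := fun y hy hyx => by
      rw [abs_of_nonneg (hnn y hy)]
      refine (hb y hy).trans ?_
      exact mul_le_mul (le_abs_self K) hyx (norm_nonneg _) (abs_nonneg _)
    have h1 := hb' _ hx1 ((CStarAlgebra.norm_posPart_le _).trans (realPart.norm_le x))
    have h2 := hb' _ hx2 ((CStarAlgebra.norm_negPart_le _).trans (realPart.norm_le x))
    rw [hR₀, Real.norm_eq_abs]
    change |g _ - g _| ≤ _
    refine (abs_sub _ _).trans ?_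
    linarith
  -- The complex extension is `x ↦ R(x) - i R(ix)`; for positive `x` the real part of `ix` vanishes.
  refine ⟨R.extendRCLike, fun x hx => ?_⟩
  have hsa := IsSelfAdjoint.of_nonneg hx
  have g0 : g 0 = 0 := by have := hadd 0 0 le_rfl le_rfl; rw [add_zero] at this; linarith
  have hRx : ∀ x, R x = G (realPart x : F) := fun _ => rfl
  have h1 : R x = g x := by
    rw [hRx, hsa.coe_realPart]
    have := hG x 0 hx le_rfl
    rwa [sub_zero, g0, sub_zero] at this
  have h2 : R (Complex.I • x) = 0 := by
    have : ((realPart (Complex.I • x) : selfAdjoint F) : F) = 0 - 0 := by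
      rw [realPart_I_smul, hsa.imaginaryPart]; simp
    rw [hRx, this, hG 0 0 le_rfl le_rfl, sub_self]
  rw [StrongDual.extendRCLike_apply, h1]
  change (g x : ℂ) - Complex.I * (R (Complex.I • x) : ℂ) = _
  rw [h2]
  simp

/-- Polarisation: expanding the hypothesis at `y + z` and at `y + iz` gives the sum and the
difference of the desired identity and its companion. -/
theorem map_mul_comm_of_star_mul {φ : F →L[ℂ] ℂ}
    (h : ∀ y : F, φ (star y * y) = φ (y * star y)) (y z : F) : φ (y * z) = φ (z * y) := by
  obtain ⟨y, rfl⟩ := star_involutive.surjective y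
  have h1 := h (y + z)
  have h2 := h (y + Complex.I • z)
  simp only [star_add, star_smul, add_mul, mul_add, map_add, smul_mul_assoc, mul_smul_comm,
    map_smul, h y, h z, RCLike.star_def, Complex.conj_I, smul_eq_mul] at h1 h2
  have hI : Complex.I * Complex.I = -1 := Complex.I_mul_I
  have h3 : φ (star y * z) + φ (star z * y) = φ (y * star z) + φ (z * star y) := by
    linear_combination h1
  have h4 : φ (star y * z) - φ (star z * y) = φ (z * star y) - φ (y * star z) := by
    linear_combination (-Complex.I) * h2 + (φ (star y * z) - φ (star z * y) - φ (z * star y) +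
      φ (y * star z)) * hI
  linear_combination (h3 + h4) / 2

end Functionals

/-! ## Bounded traces on the central sequence algebra -/

section InducedTrace

variable {B : Type*} [NonUnitalCStarAlgebra B] {ω : Ultrafilter ℕ}

theorem centralMk_surjective : Function.Surjective (centralMk ω B) := CStarIdeal.toQuot_surjective _

theorem commute_diagEmb (b : B) (x : relComm ω B) :
    Commute (diagEmb ω B b) (x : Ultrapower ω B) := mem_relComm.mp x.2 b

theorem diagEmb_mul_eq_of_centralMk_eq (b : B) {x y : relComm ω B}
    (h : centralMk ω B x = centralMk ω B y) :
    diagEmb ω B b * (x : Ultrapower ω B) = diagEmb ω B b * (y : Ultrapower ω B) := by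
  rw [← sub_eq_zero, ← map_sub] at h
  have h1 : ∀ b : B, ((x - y : relComm ω B) : Ultrapower ω B) * diagEmb ω B b = 0 ∧
      diagEmb ω B b * ((x - y : relComm ω B) : Ultrapower ω B) = 0 :=
    (CStarIdeal.toQuot_eq_zero _).mp h
  have h2 := (h1 b).2
  rw [NonUnitalStarSubalgebra.coe_sub, mul_sub] at h2
  exact sub_eq_zero.mp h2

/-- Positivity of `x` is given in the ultrapower, so its square root has to be shown to lie in the
relative commutant. -/
theorem centralMk_nonneg {x : relComm ω B} (hx : 0 ≤ (x : Ultrapower ω B)) :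
    0 ≤ centralMk ω B x := by
  have hs := (IsSelfAdjoint.of_nonneg (CFC.sqrt_nonneg (x : Ultrapower ω B))).star_eq
  have hmem : CFC.sqrt (x : Ultrapower ω B) ∈ relComm ω B := by
    refine mem_relComm.mpr fun b => ?_
    rw [CFC.sqrt_eq_real_sqrt _ hx]
    exact ((commute_diagEmb b x).symm.cfcₙ_real _).symm
  have : x = star ⟨_, hmem⟩ * (⟨_, hmem⟩ : relComm ω B) := Subtype.ext (by
    change (x : Ultrapower ω B) = star (CFC.sqrt _) * CFC.sqrt _
    rw [hs, CFC.sqrt_mul_sqrt_self _ hx])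
  rw [this, map_mul, map_star]
  exact star_mul_self_nonneg _

/-- If `d` lifts `y^{1/2}` with almost minimal norm, then `d* d` is a positive lift of `y`. -/
theorem exists_centralMk_lift {y : CentralSeqAlg ω B} (hy : 0 ≤ y) {ε : ℝ} (hε : 0 < ε) :
    ∃ x : relComm ω B, 0 ≤ (x : Ultrapower ω B) ∧ centralMk ω B x = y ∧
      ‖(x : Ultrapower ω B)‖ ≤ ‖y‖ + ε := by
  have hs := (IsSelfAdjoint.of_nonneg (CFC.sqrt_nonneg y)).star_eq
  have hlt : √‖y‖ < √(‖y‖ + ε) := Real.sqrt_lt_sqrt (norm_nonneg y) (by linarith)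
  obtain ⟨d, hd, hdn⟩ := (annihilator ω B).exists_norm_lt (CFC.sqrt y) (sub_pos.mpr hlt)
  rw [CFC.norm_sqrt y hy, add_sub_cancel] at hdn
  have hd' : centralMk ω B d = CFC.sqrt y := hd
  refine ⟨star d * d, star_mul_self_nonneg (d : Ultrapower ω B), ?_, ?_⟩
  · rw [map_mul, map_star, hd', hs, CFC.sqrt_mul_sqrt_self y hy]
  · change ‖star (d : Ultrapower ω B) * (d : Ultrapower ω B)‖ ≤ _
    rw [CStarRing.norm_star_mul_self, ← Real.mul_self_sqrt (show 0 ≤ ‖y‖ + ε by positivity)]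
    exact mul_le_mul hdn.le hdn.le (norm_nonneg _) (Real.sqrt_nonneg _)

/-- The product `b x` in `B_ω` for `b ∈ B` and the class `[x] ∈ F_ω(B)` of `x ∈ B_ω ∩ B'`. -/
noncomputable def centralAct (b : B) (y : CentralSeqAlg ω B) : Ultrapower ω B :=
  diagEmb ω B b * (Function.surjInv centralMk_surjective y : relComm ω B)

theorem centralAct_centralMk (b : B) (x : relComm ω B) :
    centralAct b (centralMk ω B x) = diagEmb ω B b * x :=
  diagEmb_mul_eq_of_centralMk_eq b (Function.surjInv_eq centralMk_surjective _)

variable [PartialOrder B] [StarOrderedRing B] {τ : ℕ → LSCTrace B} {b : B}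

theorem genLim_mul_le (hb : 0 ≤ b) {x : relComm ω B} (hx : 0 ≤ (x : Ultrapower ω B)) :
    genLim ω τ (diagEmb ω B b * x) ≤
      ENNReal.ofReal ‖(x : Ultrapower ω B)‖ * genLim ω τ (diagEmb ω B b) := by
  rw [← val_genLimTrace, ← val_genLimTrace]
  exact LSCTrace.val_mul_le_norm _ hx (map_nonneg _ hb) (commute_diagEmb b x)

theorem genLim_mul_lt_top (hb : 0 ≤ b) (hfin : genLim ω τ (diagEmb ω B b) < ∞) {x : relComm ω B}
    (hx : 0 ≤ (x : Ultrapower ω B)) : genLim ω τ (diagEmb ω B b * x) < ∞ :=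
  (genLim_mul_le hb hx).trans_lt (ENNReal.mul_lt_top ENNReal.ofReal_lt_top hfin)

/-- Positive lifts of almost minimal norm replace the norm of a lift by the quotient norm. -/
theorem genLim_centralAct_le (hb : 0 ≤ b) (hfin : genLim ω τ (diagEmb ω B b) < ∞)
    {y : CentralSeqAlg ω B} (hy : 0 ≤ y) :
    (genLim ω τ (centralAct b y)).toReal ≤ (genLim ω τ (diagEmb ω B b)).toReal * ‖y‖ := by
  set K := (genLim ω τ (diagEmb ω B b)).toReal with hK
  have key : ∀ ε : ℝ, 0 < ε → (genLim ω τ (centralAct b y)).toReal ≤ K * (‖y‖ + ε) := by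
    intro ε hε
    obtain ⟨x, hx, rfl, hxn⟩ := exists_centralMk_lift hy hε
    rw [centralAct_centralMk]
    have := ENNReal.toReal_mono (ENNReal.mul_ne_top ENNReal.ofReal_ne_top hfin.ne)
      (genLim_mul_le (τ := τ) hb hx)
    rw [ENNReal.toReal_mul, ENNReal.toReal_ofReal (norm_nonneg _), ← hK, mul_comm] at this
    exact this.trans (mul_le_mul_of_nonneg_left hxn ENNReal.toReal_nonneg)
  have hlim : Tendsto (fun ε : ℝ => K * (‖y‖ + ε)) (𝓝[>] 0) (𝓝 (K * (‖y‖ + 0))) :=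
    (Continuous.tendsto (by fun_prop) 0).mono_left nhdsWithin_le_nhds
  rw [add_zero] at hlim
  exact ge_of_tendsto hlim (eventually_nhdsWithin_of_forall fun ε hε => key ε hε)

namespace IsInducedTrace

theorem apply_eq {φ : CentralSeqAlg ω B →L[ℂ] ℂ} (h : IsInducedTrace ω τ b φ)
    {y : CentralSeqAlg ω B} (hy : 0 ≤ y) : φ y = ((genLim ω τ (centralAct b y)).toReal : ℂ) := by
  obtain ⟨x, hx, rfl, -⟩ := exists_centralMk_lift hy one_pos
  have h0 := Complex.nonneg_iff.mp (h.nonneg _ hy)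
  rw [centralAct_centralMk, h.apply_mk x hx, ENNReal.toReal_ofReal h0.1]
  exact Complex.ext rfl h0.2.symm

theorem unique {φ ψ : CentralSeqAlg ω B →L[ℂ] ℂ} (hφ : IsInducedTrace ω τ b φ)
    (hψ : IsInducedTrace ω τ b ψ) : φ = ψ :=
  ContinuousLinearMap.ext_nonneg fun y hy => by rw [hφ.apply_eq hy, hψ.apply_eq hy]

theorem norm_le {φ : CentralSeqAlg ω B →L[ℂ] ℂ} (h : IsInducedTrace ω τ b φ) (hb : 0 ≤ b)
    (hfin : genLim ω τ (diagEmb ω B b) < ∞) :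
    ‖φ‖ ≤ 4 * (genLim ω τ (diagEmb ω B b)).toReal :=
  ContinuousLinearMap.norm_le_of_nonneg ENNReal.toReal_nonneg fun y hy => by
    rw [h.apply_eq hy, Complex.norm_real, Real.norm_of_nonneg ENNReal.toReal_nonneg]
    exact genLim_centralAct_le hb hfin hy

end IsInducedTrace

theorem exists_isInducedTrace (hb : 0 ≤ b) (hfin : genLim ω τ (diagEmb ω B b) < ∞) :
    ∃ φ : CentralSeqAlg ω B →L[ℂ] ℂ, IsInducedTrace ω τ b φ := by
  have hb' : 0 ≤ diagEmb ω B b := map_nonneg _ hb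
  obtain ⟨φ, hφ⟩ := exists_clm_of_additive
    (fun y : CentralSeqAlg ω B => (genLim ω τ (centralAct b y)).toReal)
    (K := (genLim ω τ (diagEmb ω B b)).toReal) (by
      intro y z hy hz
      obtain ⟨x, hx, rfl, -⟩ := exists_centralMk_lift hy one_pos
      obtain ⟨w, hw, rfl, -⟩ := exists_centralMk_lift hz one_pos
      rw [← map_add, centralAct_centralMk, centralAct_centralMk, centralAct_centralMk,
        NonUnitalStarSubalgebra.coe_add, mul_add, ← val_genLimTrace, LSCTrace.val_add _
          ((commute_diagEmb b x).mul_nonneg hb' hx) ((commute_diagEmb b w).mul_nonneg hb' hw),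
        val_genLimTrace, val_genLimTrace, ENNReal.toReal_add (genLim_mul_lt_top hb hfin hx).ne
          (genLim_mul_lt_top hb hfin hw).ne]) (by
      intro c y hc hy
      obtain ⟨x, hx, rfl, -⟩ := exists_centralMk_lift hy one_pos
      have e : c • centralMk ω B x = centralMk ω B ((c : ℂ) • x) :=
        (map_smul (centralMk ω B) (c : ℂ) x).symm
      have e' : diagEmb ω B b * (((c : ℂ) • x : relComm ω B) : Ultrapower ω B) =
          c • (diagEmb ω B b * (x : Ultrapower ω B)) := mul_smul_comm (c : ℂ) _ _
      rw [e, centralAct_centralMk, centralAct_centralMk, e', ← val_genLimTrace,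
        LSCTrace.val_smul _ hc ((commute_diagEmb b x).mul_nonneg hb' hx), val_genLimTrace,
        ENNReal.toReal_mul, ENNReal.toReal_ofReal hc])
    (fun _ _ => ENNReal.toReal_nonneg) (fun y hy => genLim_centralAct_le hb hfin hy)
  refine ⟨φ, fun y hy => ?_, map_mul_comm_of_star_mul fun y => ?_, fun x hx => ?_⟩
  · rw [hφ y hy]
    exact_mod_cast (ENNReal.toReal_nonneg : 0 ≤ (genLim ω τ (centralAct b y)).toReal)
  · rw [hφ _ (star_mul_self_nonneg y), hφ _ (mul_star_self_nonneg y)]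
    obtain ⟨d, rfl⟩ := centralMk_surjective y
    have hd := commute_diagEmb b d
    have hd' := commute_diagEmb b (star d)
    have h1 : (((star d * d : relComm ω B)) : Ultrapower ω B) =
      star (d : Ultrapower ω B) * (d : Ultrapower ω B) := rfl
    have h2 : (((d * star d : relComm ω B)) : Ultrapower ω B) =
      (d : Ultrapower ω B) * star (d : Ultrapower ω B) := rfl
    -- Since `b` commutes with the lift `d`, the claim is the twisted trace property `τ(d* d b) =
    -- τ(d d* b)` of the limit trace.
    rw [← map_star, ← map_mul, ← map_mul, centralAct_centralMk, centralAct_centralMk,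
      (commute_diagEmb b _).eq, (commute_diagEmb b _).eq, h1, h2, ← val_genLimTrace,
      LSCTrace.val_star_mul_mul _ hb' hd, val_genLimTrace]
  · rw [hφ _ (centralMk_nonneg hx), Complex.ofReal_re, centralAct_centralMk,
      ENNReal.ofReal_toReal (genLim_mul_lt_top hb hfin hx).ne]

theorem existsUnique_isInducedTrace (hb : 0 ≤ b) (hfin : genLim ω τ (diagEmb ω B b) < ∞) :
    ∃! φ : CentralSeqAlg ω B →L[ℂ] ℂ, IsInducedTrace ω τ b φ :=
  existsUnique_of_exists_of_unique (exists_isInducedTrace hb hfin) fun _ _ h h' => h.unique h'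

end InducedTrace

/-! ## Comparison of the limit traces on `A` and `A ⊗ 𝕂` -/

section Comparison

variable {A : Type*} [NonUnitalCStarAlgebra A] [PartialOrder A] [StarOrderedRing A]
  {ω : Ultrafilter ℕ}

/-- Cut-downs commute with ⋆-homomorphisms, so the two limit traces agree coordinate by coordinate.
For `x ↦ x ⊗ e_00` this identifies the restriction of `σ` to that corner with `τ`. -/
theorem genLim_seqMap {B C : Type*} [NonUnitalCStarAlgebra B] [PartialOrder B] [StarOrderedRing B]
    [NonUnitalCStarAlgebra C] [PartialOrder C] [StarOrderedRing C] (σ : ℕ → LSCTrace C)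
    (f : B →⋆ₙₐ[ℂ] C) {u : BddSeq B} (hu : ∀ n, 0 ≤ u n) :
    genLim ω σ (ultraMk ω C (seqMap (fun _ => f) u)) =
      genLim ω (fun n => (σ n).comap f) (ultraMk ω B u) := by
  have hfu : ∀ n, 0 ≤ seqMap (fun _ => f) u n := fun n => map_nonneg f (hu n)
  rw [genLim_ultraMk _ hfu, genLim_ultraMk _ hu, genLimSeq_eq, genLimSeq_eq]
  refine iSup_congr fun ε => iSup_congr fun hε => ?_
  unfold cutLim
  congr 1
  funext n
  rw [LSCTrace.val_comap _ _ (cutDown_nonneg _ _), map_cutDown f (hu n) hε.le, seqMap_apply]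

theorem ampl_one_mul_ampl {n : ℕ} (hn : 1 ≤ n) (d x : A) :
    ampl 1 d * ampl n x = ampl 1 (d * x) := by
  change corner 1 (diagHom 1 d) * ampl n x = corner 1 (diagHom 1 (d * x))
  rw [corner_mul_ampl hn]
  congr 1
  refine MatAlg.ext fun i j => ?_
  rw [MatAlg.entry_of, diagHom_entry, diagHom_entry, ite_mul, zero_mul]

/-- Coordinatewise `(d ⊗ e_00)(x_n ⊗ 1_n) = d x_n ⊗ e_00`, which fails only at `n = 0`, where `1_0 =
0`; freeness of `ω` discards that index. Allowing any representative `u` of `d x` permits a positive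
one later. -/
theorem diagEmb_ampl_one_mul_ultraPhi (hω : (ω : Filter ℕ) ≤ cofinite) (d : A) {x : Ultrapower ω A}
    {u : BddSeq A} (hu : ultraMk ω A u = diagEmb ω A d * x) :
    diagEmb ω (Stab A) (ampl 1 d) * ultraPhi A ω x =
      ultraMk ω (Stab A) (seqMap (fun _ => ampl 1) u) := by
  obtain ⟨w, rfl⟩ := ultraMk_surjective A x
  rw [ultraMk_const_mul, ← sub_eq_zero, ← map_sub, ultraMk_eq_zero] at hu
  rw [ultraPhi_ultraMk, ultraMk_const_mul]
  have h1 : ∀ᶠ n in (ω : Filter ℕ), 1 ≤ n :=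
    hω (by rw [Nat.cofinite_eq_atTop]; exact eventually_ge_atTop 1)
  have e : ultraMk ω (Stab A)
      (seqOf (fun _ => NonUnitalStarAlgHom.id ℂ (Stab A)) (ampl 1 d) * seqMap ampl w) =
      ultraMk ω (Stab A) (seqMap (fun _ => ampl 1)
        (seqOf (fun _ => NonUnitalStarAlgHom.id ℂ A) d * w)) := by
    refine ultraMk_eq_of_eventuallyEq ?_
    filter_upwards [h1] with n hn
    exact ampl_one_mul_ampl hn d (w n)
  rw [e, eq_comm, ← sub_eq_zero, ← map_sub, ← map_sub, ultraMk_eq_zero]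
  exact squeeze_zero (fun n => norm_nonneg _)
    (fun n => NonUnitalStarAlgHom.norm_apply_le (ampl 1) _) hu

/-- The diagonal formula for the limit trace pulled back to `A ⊗ 𝕂`. No interchange of the limit
along `ω` with the infinite sum is needed. -/
theorem genLim_diagEmb_eq_tsum (σ : ℕ → LSCTrace (Stab A)) {a : Stab A} (ha : 0 ≤ a) :
    genLim ω σ (diagEmb ω (Stab A) a) =
      ∑' i, genLim ω (fun n => (σ n).comap (ampl 1)) (diagEmb ω A (Stab.entry i i a)) := by
  have := ((genLimTrace ω σ).comap (diagEmb ω (Stab A))).val_eq_tsum ha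
  rw [LSCTrace.val_comap _ _ ha, val_genLimTrace] at this
  rw [this]
  refine tsum_congr fun i => ?_
  have hi := Stab.entry_nonneg i ha
  rw [LSCTrace.val_comap _ _ hi, LSCTrace.val_comap _ _ (map_nonneg _ hi), val_genLimTrace]
  exact genLim_seqMap σ (ampl 1) (u := seqOf (fun _ => NonUnitalStarAlgHom.id ℂ A) _) fun _ => hi

/-- The diagonal formula for the trace `b ↦ σ(b Φ(x))` on `A ⊗ 𝕂`. -/
theorem genLim_diagEmb_mul_eq_tsum (hω : (ω : Filter ℕ) ≤ cofinite) (σ : ℕ → LSCTrace (Stab A))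
    {a : Stab A} (ha : 0 ≤ a) (x : relComm ω A) (hx : 0 ≤ (x : Ultrapower ω A)) :
    genLim ω σ (diagEmb ω (Stab A) a * ultraPhi A ω x) =
      ∑' i, genLim ω (fun n => (σ n).comap (ampl 1)) (diagEmb ω A (Stab.entry i i a) * x) := by
  have hΦ : 0 ≤ ultraPhi A ω x := map_nonneg _ hx
  have hcomm : ∀ b, Commute (ultraPhi A ω x) (diagEmb ω (Stab A) b) := fun b =>
    (mem_relComm.mp (ultraPhi_mem_relComm hω x.2) b).symm
  have := ((genLimTrace ω σ).twist (diagEmb ω (Stab A)) hΦ hcomm).val_eq_tsum ha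
  rw [LSCTrace.val_twist _ _ _ _ ha, val_genLimTrace] at this
  rw [this]
  refine tsum_congr fun i => ?_
  have hi := Stab.entry_nonneg i ha
  obtain ⟨v, hv⟩ := exists_nonneg_lift ((commute_diagEmb _ x).mul_nonneg (map_nonneg _ hi) hx)
  rw [LSCTrace.val_comap _ _ hi, LSCTrace.val_twist _ _ _ _ (map_nonneg _ hi), val_genLimTrace,
    diagEmb_ampl_one_mul_ultraPhi hω _ hv, genLim_seqMap _ _ fun n => star_mul_self_nonneg (v n),
    hv]

end Comparison

theorem mainTheorem7 {A : Type*} [NonUnitalCStarAlgebra A] [PartialOrder A] [StarOrderedRing A]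
    [TopologicalSpace.SeparableSpace A]
    (ω : Ultrafilter ℕ) (hω : (ω : Filter ℕ) ≤ Filter.cofinite)
    (σ : ℕ → LSCTrace (Stab A)) :
    (∃! τ : ℕ → LSCTrace A, ∀ n, IsTensorTr (σ n) (τ n)) ∧
    ∀ τ : ℕ → LSCTrace A, (∀ n, IsTensorTr (σ n) (τ n)) →
    ∀ a : Stab A, 0 ≤ a → genLim ω σ (diagEmb ω (Stab A) a) < ∞ →
      (∀ i : ℕ, genLim ω τ (diagEmb ω A (Stab.entry i i a)) < ∞) ∧
      (∃! ψ : CentralSeqAlg ω (Stab A) →L[ℂ] ℂ, IsInducedTrace ω σ a ψ) ∧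
      (∀ i : ℕ, ∃! φ : CentralSeqAlg ω A →L[ℂ] ℂ, IsInducedTrace ω τ (Stab.entry i i a) φ) ∧
      ∀ (ψ : CentralSeqAlg ω (Stab A) →L[ℂ] ℂ) (φ : ℕ → CentralSeqAlg ω A →L[ℂ] ℂ),
        IsInducedTrace ω σ a ψ → (∀ i, IsInducedTrace ω τ (Stab.entry i i a) (φ i)) →
        HasSum φ (ψ.comp (centralPhiL A hω)) := by
  refine ⟨⟨fun n => (σ n).comap (ampl 1), fun n => isTensorTr_iff.mpr rfl,
    fun τ hτ => funext fun n => isTensorTr_iff.mp (hτ n)⟩, fun τ hτ a ha hfin => ?_⟩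
  obtain rfl : τ = fun n => (σ n).comap (ampl 1) := funext fun n => isTensorTr_iff.mp (hτ n)
  have hent : ∀ i, 0 ≤ Stab.entry i i a := fun i => Stab.entry_nonneg i ha
  have hne := hfin.ne
  rw [genLim_diagEmb_eq_tsum σ ha] at hne
  have hT : ∀ i, genLim ω (fun n => (σ n).comap (ampl 1)) (diagEmb ω A (Stab.entry i i a)) < ∞ :=
    fun i => (ENNReal.ne_top_of_tsum_ne_top hne i).lt_top
  refine ⟨hT, existsUnique_isInducedTrace ha hfin,
    fun i => existsUnique_isInducedTrace (hent i) (hT i), fun ψ φ hψ hφ => ?_⟩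
  -- The norms are dominated by `4 τ(a_ii)`, whose sum is `4 σ(a) < ∞`.
  have hsum : Summable φ := Summable.of_norm_bounded ((ENNReal.summable_toReal hne).mul_left 4)
    fun i => (hφ i).norm_le (hent i) (hT i)
  -- Both sides are bounded functionals, so it suffices to compare them at the class of a positive
  -- `x`, where the claim is `σ(a Φ(x)) = ∑ τ(a_ii x)` with finite terms.
  have heq : ∑' i, φ i = ψ.comp (centralPhiL A hω) := by
    refine ContinuousLinearMap.ext_nonneg fun y hy => ?_
    have h1 : HasSum (fun i => φ i y) ((∑' i, φ i) y) :=
      hsum.hasSum.mapL (ContinuousLinearMap.apply ℂ ℂ y)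
    refine h1.unique ?_
    obtain ⟨x, hx, rfl, -⟩ := exists_centralMk_lift hy one_pos
    have hΦ : 0 ≤ (commPhi A hω x : Ultrapower ω (Stab A)) := map_nonneg (ultraPhi A ω) hx
    have h2 := genLim_diagEmb_mul_eq_tsum hω σ ha x hx
    have hlt := genLim_mul_lt_top ha hfin hΦ
    change genLim ω σ (diagEmb ω (Stab A) a * ultraPhi A ω x) < ∞ at hlt
    rw [h2] at hlt
    have h3 := ENNReal.hasSum_toReal hlt.ne
    rw [← ENNReal.tsum_toReal_eq (ENNReal.ne_top_of_tsum_ne_top hlt.ne), ← h2] at h3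
    change HasSum _ (ψ (centralPhi A hω (centralMk ω A x)))
    rw [centralPhi_centralMk, hψ.apply_eq (centralMk_nonneg hΦ), centralAct_centralMk]
    simp only [(hφ _).apply_eq (centralMk_nonneg hx), centralAct_centralMk]
    exact Complex.hasSum_ofReal.mpr h3
  rw [← heq]
  exact hsum.hasSum
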